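/- A $\mathrm{CAT}(0)$ space is a complete geodesic metric space whose geodesic triangles are not thicker than their Euclidean comparison triangles. A bounded sequence $(x_n)$ in a $\mathrm{CAT}(0)$ space $X$ converges weakly to $x\in X$ if, for every compact geodesic $c$ starting at $x$, the closest-point projections of $x_n$ to $c$ converge to $x$. The weak topology $\mathcal T_\Delta$ on $X$ is the topology whose closed sets are the sets $A\subset X$ that contain the weak limit of every bounded weakly converging sequence of points of $A$. Let $Y$ be the metric tree with a centre $p$, edges $[p,b_i]$ ($i\in\mathbb N$), and edges $[b_i,e_{ij}]$ ($i,j\in\mathbb N$), all of length $\pi/4$ and with no other identifications. Let $\hat X$ be the Euclidean cone over $Y$ with tip $o$: its points are $\lambda\cdot y$ with $\lambda\ge 0$, $y\in Y$, where $0\cdot y=o$ for all $y$, and $$d(\lambda\cdot y,\mu\cdot z)^2=\lambda^2+\mu^2-2\lambda\mu\cos\bigl(\min(\pi,d_Y(y,z))\bigr).$$ For an edge $I=[y_1,y_2]$ of $Y$ let $S_I\subset\hat X$ be the triangle with vertices $o$, $2\cdot y_1$, $2\cdot y_2$, that is, the convex hull of these three points in the planar sector that is the cone over $I$. Let $X\subset\hat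 X$ be the union of all the triangles $S_I$, with the metric of $\hat X$. Then $X$ is a bounded, separable $\mathrm{CAT}(0)$ space. It is a two-dimensional Euclidean simplicial complex with its length metric, it has countably many simplices, and its $2$-simplices are precisely the triangles $S_I$. The points $o$ and $\frac12\cdot p$ of $X$ do not have disjoint $\mathcal T_\Delta$-open neighbourhoods; in particular, $\mathcal T_\Delta$ is not Hausdorff. Consequently, there exists a bounded, separable, two-dimensional $\mathrm{CAT}(0)$ simplicial complex whose weak topology $\mathcal T_\Delta$ is not Hausdorff. -/

import Mathlib

open scoped NNReal Topology

noncomputable section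

/-! ### Geodesics, CAT(0) spaces, weak convergence and the weak topology -/

/-- The metric segment between `x` and `y`. In a geodesic space this is the union of all geodesics
joining `x` to `y`. -/
def metricSegment {X : Type*} [MetricSpace X] (x y : X) : Set X :=
  {z | dist x z + dist z y = dist x y}

/-- `γ` restricted to `[0, L]` is a (compact, unit speed) geodesic. -/
def IsGeodesic {X : Type*} [MetricSpace X] (γ : ℝ → X) (L : ℝ) : Prop :=
  0 ≤ L ∧ ∀ s ∈ Set.Icc 0 L, ∀ t ∈ Set.Icc 0 L, dist (γ s) (γ t) = |s - t|

/-- A CAT(0) space: a complete geodesic metric space all of whose geodesic triangles are not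
thicker than their Euclidean comparison triangles. The points `x` and `y` lie on the sides `[p, q]`
and `[p, r]` of a triangle, and the primed points are the corresponding points of a comparison
triangle in the Euclidean plane. -/
structure IsCAT0 (X : Type*) [MetricSpace X] : Prop where
  complete : CompleteSpace X
  geodesic : ∀ x y : X, ∃ γ : ℝ → X, IsGeodesic γ (dist x y) ∧ γ 0 = x ∧ γ (dist x y) = y
  comparison : ∀ (p q r x y : X) (p' q' r' x' y' : EuclideanSpace ℝ (Fin 2)),
    dist p' q' = dist p q → dist p' r' = dist p r → dist q' r' = dist q r →
    x ∈ metricSegment p q → dist p' x' = dist p x → dist x' q' = dist x q →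
    y ∈ metricSegment p r → dist p' y' = dist p y → dist y' r' = dist y r →
    dist x y ≤ dist x' y'

/-- `q` is a closest point to `y` in `c`. -/
def IsClosestPoint {X : Type*} [MetricSpace X] (c : Set X) (y q : X) : Prop :=
  q ∈ c ∧ ∀ z ∈ c, dist y q ≤ dist y z

/-- Weak convergence of the bounded sequence `u` to `x`: for every compact geodesic starting
at `x`, the closest-point projections of `u n` to it converge to `x`. -/
def WeaklyConverges {X : Type*} [MetricSpace X] (u : ℕ → X) (x : X) : Prop :=
  Bornology.IsBounded (Set.range u) ∧
    ∀ (γ : ℝ → X) (L : ℝ), IsGeodesic γ L → γ 0 = x →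
      ∀ q : ℕ → X, (∀ n, IsClosestPoint (γ '' Set.Icc 0 L) (u n) (q n)) →
        Filter.Tendsto q Filter.atTop (𝓝 x)

/-- A set is weakly closed if it contains all weak limits of its bounded sequences. -/
def IsWeaklyClosed {X : Type*} [MetricSpace X] (A : Set X) : Prop :=
  ∀ (u : ℕ → X) (x : X), (∀ n, u n ∈ A) → WeaklyConverges u x → x ∈ A

theorem IsGeodesic.isCompact_image {X : Type*} [MetricSpace X] {γ : ℝ → X} {L : ℝ}
    (h : IsGeodesic γ L) : IsCompact (γ '' Set.Icc 0 L) := by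
  refine isCompact_Icc.image_of_continuousOn ?_
  refine LipschitzOnWith.continuousOn (K := 1) (LipschitzOnWith.of_dist_le_mul ?_)
  intro s hs t ht
  rw [h.2 s hs t ht]
  simp [Real.dist_eq]

theorem WeaklyConverges.comp {X : Type*} [MetricSpace X] {u : ℕ → X} {x : X}
    (h : WeaklyConverges u x) {φ : ℕ → ℕ} (hφ : StrictMono φ) : WeaklyConverges (u ∘ φ) x := by
  refine ⟨h.1.subset (Set.range_comp_subset_range φ u), fun γ L hγ h0 q hq => ?_⟩
  have hex : ∀ n, ∃ z, IsClosestPoint (γ '' Set.Icc 0 L) (u n) z := by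
    intro n
    obtain ⟨z, hz, hmin⟩ := hγ.isCompact_image.exists_isMinOn
      ⟨γ 0, 0, ⟨le_refl _, hγ.1⟩, rfl⟩ (f := fun z => dist (u n) z) (by fun_prop)
    exact ⟨z, hz, fun w hw => hmin hw⟩
  choose z hz using hex
  classical
  have key := h.2 γ L hγ h0
    (fun n => if hn : ∃ k, φ k = n then q hn.choose else z n) (fun n => by
      by_cases hn : ∃ k, φ k = n
      · simp only [hn, dif_pos]
        have := hq hn.choose
        simpa [hn.choose_spec] using this
      · simp only [hn, dif_neg, not_false_eq_true]
        exact hz n)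
  have := key.comp hφ.tendsto_atTop
  refine this.congr fun k => ?_
  have hk : ∃ k', φ k' = φ k := ⟨k, rfl⟩
  simp only [Function.comp, hk, dif_pos]
  rw [hφ.injective hk.choose_spec]

/-- The weak topology `T_Δ`: the topology whose closed sets are the weakly closed sets. -/
@[reducible] def weakTopology (X : Type*) [MetricSpace X] : TopologicalSpace X :=
  TopologicalSpace.ofClosed {A | IsWeaklyClosed A}
    (fun _ _ hu _ => (hu 0).elim)
    (fun _ hA u x hu hx B hB => hA hB u x (fun n => hu n B hB) hx)
    (fun A hA B hB u x hu hx => by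
      by_cases h : ∃ᶠ n in Filter.atTop, u n ∈ A
      · obtain ⟨φ, hφ, hφA⟩ := Filter.extraction_of_frequently_atTop h
        exact Or.inl (hA _ x hφA (hx.comp hφ))
      · rw [Filter.not_frequently] at h
        obtain ⟨φ, hφ, hφB⟩ := Filter.extraction_of_frequently_atTop
          (h.mono fun n hn => (hu n).resolve_left hn).frequently
        exact Or.inr (hB _ x hφB (hx.comp hφ)))

/-! ### Euclidean simplicial complexes -/

/-- The structure of a (Euclidean) simplicial complex on a set `X`: an abstract simplicial complex
`K`, an identification of `X` with the geometric realization of `K` through barycentric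
coordinates, and, for each simplex of `K`, a nondegenerate Euclidean simplex with the same vertices,
such that common vertices of two simplices have the same distance in both (so that simplices
are glued by isometries of faces). -/
structure EuclideanComplex (X : Type*) where
  V : Type
  K : AbstractSimplicialComplex V
  bary : X → V → ℝ
  bary_injective : Function.Injective bary
  range_bary : Set.range bary =
    {w | (∀ v, 0 ≤ w v) ∧ ∃ s ∈ K.faces, Function.support w = (s : Set V) ∧ ∑ v ∈ s, w v = 1}
  vertex : (s : Finset V) → s → EuclideanSpace ℝ s
  affineIndependent : ∀ s ∈ K.faces, AffineIndependent ℝ (vertex s)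
  dist_vertex : ∀ s ∈ K.faces, ∀ t ∈ K.faces,
    ∀ (v w : V) (hvs : v ∈ s) (hws : w ∈ s) (hvt : v ∈ t) (hwt : w ∈ t),
      dist (vertex s ⟨v, hvs⟩) (vertex s ⟨w, hws⟩) = dist (vertex t ⟨v, hvt⟩) (vertex t ⟨w, hwt⟩)

namespace EuclideanComplex

variable {X : Type*} (C : EuclideanComplex X)

/-- The closed simplex of `X` spanned by `s`. -/
def closedSimplex (s : Finset C.V) : Set X :=
  {x | Function.support (C.bary x) ⊆ (s : Set C.V)}

/-- The position, in the Euclidean simplex attached to `s`, of a point of the closed simplex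
spanned by `s`. -/
def position (s : Finset C.V) (x : X) : EuclideanSpace ℝ s :=
  ∑ v : s, C.bary x v • C.vertex s v

/-- The lengths of the strings from `x` to `y`: finite sequences of points such that any two
consecutive points lie in a common closed simplex, in which their distance is measured. -/
def stringLengths (x y : X) : Set ℝ :=
  {l | ∃ (n : ℕ) (z : ℕ → X) (s : ℕ → Finset C.V), z 0 = x ∧ z n = y ∧
    (∀ i < n, s i ∈ C.K.faces ∧ z i ∈ C.closedSimplex (s i) ∧ z (i + 1) ∈ C.closedSimplex (s i)) ∧
    l = ∑ i ∈ Finset.range n, dist (C.position (s i) (z i)) (C.position (s i) (z (i + 1)))}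

/-- The metric of `X` is the length metric of the complex. -/
def InducesMetric [MetricSpace X] : Prop :=
  ∀ x y : X, IsGLB (C.stringLengths x y) (dist x y)

/-- The complex has dimension `n`. -/
def HasDimension (n : ℕ) : Prop :=
  (∀ s ∈ C.K.faces, s.card ≤ n + 1) ∧ ∃ s ∈ C.K.faces, s.card = n + 1

end EuclideanComplex

/-! ### Euclidean cones -/

/-- The distance `√(a² + b² - 2 a b cos θ)` of the endpoints of two planar segments of lengths
`a` and `b` that make the angle `θ` at their common initial point. -/
def coneDist (a b θ : ℝ) : ℝ := √(a ^ 2 + b ^ 2 - 2 * a * b * Real.cos θ)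

theorem coneDist_eq_norm (a b α β : ℝ) :
    coneDist a b (α - β) =
      ‖(a : ℂ) * Complex.exp (α * Complex.I) - b * Complex.exp (β * Complex.I)‖ := by
  rw [Complex.norm_eq_sqrt_sq_add_sq, coneDist]
  congr 1
  simp only [Complex.sub_re, Complex.sub_im, Complex.re_ofReal_mul, Complex.im_ofReal_mul,
    Complex.exp_ofReal_mul_I_re, Complex.exp_ofReal_mul_I_im]
  rw [Real.cos_sub]
  linear_combination -a ^ 2 * Real.sin_sq_add_cos_sq α - b ^ 2 * Real.sin_sq_add_cos_sq β

theorem coneDist_mono {a b θ θ' : ℝ} (ha : 0 ≤ a) (hb : 0 ≤ b) (h0 : 0 ≤ θ) (h : θ ≤ θ')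
    (hπ : θ' ≤ Real.pi) : coneDist a b θ ≤ coneDist a b θ' := by
  unfold coneDist
  apply Real.sqrt_le_sqrt
  have := Real.cos_le_cos_of_nonneg_of_le_pi h0 hπ h
  nlinarith [mul_le_mul_of_nonneg_left this (mul_nonneg ha hb)]

theorem coneDist_triangle (a b c θ φ : ℝ) :
    coneDist a c (θ + φ) ≤ coneDist a b θ + coneDist b c φ := by
  have h1 := coneDist_eq_norm a c θ (-φ)
  have h2 := coneDist_eq_norm a b θ 0
  have h3 := coneDist_eq_norm b c 0 (-φ)
  simp only [sub_neg_eq_add, sub_zero, zero_add] at h1 h2 h3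
  rw [h1, h2, h3]
  exact norm_sub_le_norm_sub_add_norm_sub _ _ _

/-- Polar coordinates on the Euclidean cone over `Y`. -/
structure ConeCoord (Y : Type*) where
  radius : ℝ≥0
  direction : Y

/-- The Euclidean cone metric, in polar coordinates. -/
instance ConeCoord.instPseudoMetricSpace (Y : Type*) [MetricSpace Y] :
    PseudoMetricSpace (ConeCoord Y) where
  dist x y := coneDist x.radius y.radius (min Real.pi (dist x.direction y.direction))
  dist_self x := by
    simp [coneDist, Real.pi_pos.le]
    ring_nf
    simp
  dist_comm x y := by
    simp only [coneDist, dist_comm x.direction y.direction]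
    ring_nf
  dist_triangle x y z := by
    have hπ := Real.pi_pos
    set θ := min Real.pi (dist x.direction y.direction) with hθ
    set φ := min Real.pi (dist y.direction z.direction) with hφ
    set ψ := min Real.pi (dist x.direction z.direction) with hψ
    have hθ0 : 0 ≤ θ := le_min hπ.le dist_nonneg
    have hφ0 : 0 ≤ φ := le_min hπ.le dist_nonneg
    have hψ0 : 0 ≤ ψ := le_min hπ.le dist_nonneg
    have hθπ : θ ≤ Real.pi := min_le_left _ _
    have hφπ : φ ≤ Real.pi := min_le_left _ _
    have hψπ : ψ ≤ Real.pi := min_le_left _ _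
    have hx := x.radius.coe_nonneg
    have hy := y.radius.coe_nonneg
    have hz := z.radius.coe_nonneg
    rcases le_total (θ + φ) Real.pi with h | h
    · have hle : ψ ≤ θ + φ := by
        have htri := dist_triangle x.direction y.direction z.direction
        have h1 : ψ ≤ dist x.direction z.direction := min_le_right _ _
        rcases min_choice Real.pi (dist x.direction y.direction) with h2 | h2 <;>
        rcases min_choice Real.pi (dist y.direction z.direction) with h3 | h3 <;>
        rw [← hθ] at h2 <;> rw [← hφ] at h3 <;> linarith
      exact (coneDist_mono hx hz hψ0 hle h).trans (coneDist_triangle _ _ _ _ _)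
    · have h1 := coneDist_mono hx hz hψ0 hψπ le_rfl
      have h2 := coneDist_triangle x.radius y.radius z.radius θ (Real.pi - θ)
      have h3 := coneDist_mono hy hz (by linarith : 0 ≤ Real.pi - θ) (by linarith) hφπ
      rw [add_sub_cancel] at h2
      linarith

/-- The Euclidean cone over the (nonempty) metric space `Y`. -/
abbrev EuclideanCone (Y : Type*) [MetricSpace Y] : Type _ := SeparationQuotient (ConeCoord Y)

/-- The point `r · y` of the cone, at distance `r` from the tip in the direction `y`. -/
def EuclideanCone.point {Y : Type*} [MetricSpace Y] (r : ℝ≥0) (y : Y) : EuclideanCone Y :=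
  SeparationQuotient.mk ⟨r, y⟩

/-! ### The tree -/

/-- Coordinates on the tree `Y`, which has a centre `p`, countably many edges `[p, b i]` at `p`
and, at each `b i`, countably many further edges `[b i, e i j]`; all edges have length `π / 4`.
The coordinates `(i, j, t)` stand for the point at distance `t` from `p` on the path from `p` through
`b i` to `e i j`, which has length `π / 2`. -/
structure TreeCoord where
  i : ℕ
  j : ℕ
  t : Set.Icc (0 : ℝ) (Real.pi / 2)

namespace TreeCoord

/-- The length of the common initial part of the paths from `p` to `e i j` and to `e i' j'`. -/
def overlap (x y : TreeCoord) : ℝ :=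
  if x.i = y.i then (if x.j = y.j then Real.pi / 2 else Real.pi / 4) else 0

/-- The distance from `p` of the point at which the paths from `p` to `x` and to `y` separate. -/
def meet (x y : TreeCoord) : ℝ := min (min (x.t : ℝ) y.t) (overlap x y)

theorem overlap_comm (x y : TreeCoord) : overlap x y = overlap y x := by
  simp only [overlap, eq_comm]

theorem overlap_ultra (x y z : TreeCoord) : min (overlap x y) (overlap y z) ≤ overlap x z := by
  have := Real.pi_pos
  unfold overlap
  split_ifs <;> first | (exfalso; omega) | (simp; try linarith)

/-- The path metric of the tree. -/
instance instPseudoMetricSpace : PseudoMetricSpace TreeCoord where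
  dist x y := x.t + y.t - 2 * meet x y
  dist_self x := by
    have : meet x x = x.t := by simpa [meet, overlap] using x.t.2.2
    rw [this]; ring
  dist_comm x y := by
    simp only [meet, overlap_comm x y, min_comm (x.t : ℝ) y.t]
    ring
  dist_triangle x y z := by
    have h := overlap_ultra x y z
    have key : min (meet x y) (meet y z) ≤ meet x z := by
      simp only [meet, le_min_iff]
      refine ⟨⟨?_, ?_⟩, le_trans (le_min ?_ ?_) h⟩ <;> simp
    have h1 : meet x y ≤ y.t := (min_le_left _ _).trans (min_le_right _ _)
    have h2 : meet y z ≤ y.t := (min_le_left _ _).trans (min_le_left _ _)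
    rcases min_choice (meet x y) (meet y z) with h3 | h3 <;> rw [h3] at key <;> linarith

end TreeCoord

/-- The metric tree `Y`. -/
abbrev ConeTree : Type := SeparationQuotient TreeCoord

/-- The centre `p` of the tree. -/
def ConeTree.p : ConeTree :=
  SeparationQuotient.mk ⟨0, 0, ⟨0, le_rfl, by positivity⟩⟩

/-- The edges of the tree: `inner i` is `[p, b i]` and `outer i j` is `[b i, e i j]`. -/
inductive TreeEdge where
  | inner (i : ℕ)
  | outer (i j : ℕ)

/-- The parametrization of an edge by arc length. -/
def TreeEdge.param : TreeEdge → Set.Icc (0 : ℝ) (Real.pi / 4) → ConeTree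
  | inner i, t => SeparationQuotient.mk
      ⟨i, 0, ⟨t, t.2.1, by linarith [t.2.2, Real.pi_pos]⟩⟩
  | outer i j, t => SeparationQuotient.mk
      ⟨i, j, ⟨Real.pi / 4 + t, by linarith [t.2.1, Real.pi_pos], by linarith [t.2.2]⟩⟩

/-! ### The complex -/

/-- The planar triangle with the vertices `0`, `2`, `2 exp (i π / 4)`. -/
def modelTriangle : Set ℂ :=
  convexHull ℝ {0, 2, 2 * Complex.exp ((Real.pi / 4 : ℝ) * Complex.I)}

/-- The triangle in the cone over the tree with the vertices `o`, `2 · y₁`, `2 · y₂`, where `y₁` and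
`y₂` are the endpoints of the edge `e`. The cone over `e` is a planar sector of angle `π / 4`; the
triangle is the convex hull of the three points in this sector. -/
def coneTriangle (e : TreeEdge) : Set (EuclideanCone ConeTree) :=
  {x | ∃ (r : ℝ≥0) (t : Set.Icc (0 : ℝ) (Real.pi / 4)),
    (r : ℂ) * Complex.exp ((t : ℝ) * Complex.I) ∈ modelTriangle ∧
      x = EuclideanCone.point r (e.param t)}

/-- The truncated cone `X`: the union of the triangles over all edges of the tree, with the metric
of the cone. -/
abbrev TruncatedCone : Type := {x : EuclideanCone ConeTree // ∃ e, x ∈ coneTriangle e}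

theorem point_p_mem (r : ℝ≥0) (hr : r ≤ 2) :
    ∃ e, EuclideanCone.point r ConeTree.p ∈ coneTriangle e := by
  refine ⟨TreeEdge.inner 0, r, ⟨0, le_rfl, by positivity⟩, ?_, rfl⟩
  have h0 : (0 : ℂ) ∈ modelTriangle := subset_convexHull ℝ _ (by simp)
  have h2 : (2 : ℂ) ∈ modelTriangle := subset_convexHull ℝ _ (by simp)
  have hr' : (r : ℝ) ≤ 2 := by exact_mod_cast hr
  have := (convex_convexHull ℝ _) h0 h2 (a := 1 - r / 2) (b := r / 2)
    (by linarith) (by positivity) (by ring)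
  have h : (r : ℂ) * Complex.exp (((0 : ℝ) : ℂ) * Complex.I) =
      (1 - (r : ℝ) / 2) • (0 : ℂ) + ((r : ℝ) / 2) • (2 : ℂ) := by
    simp
  exact h ▸ this

namespace TruncatedCone

/-- The tip `o` of the cone. -/
def o : TruncatedCone := ⟨EuclideanCone.point 0 ConeTree.p, point_p_mem 0 (by norm_num)⟩

/-- The point `p / 2`. -/
def halfP : TruncatedCone :=
  ⟨EuclideanCone.point (1 / 2) ConeTree.p, point_p_mem (1 / 2) (by
    rw [← NNReal.coe_le_coe]; norm_num)⟩

/-- The triangle over the edge `e` as a subset of the truncated cone. -/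
def triangle (e : TreeEdge) : Set TruncatedCone := {x | x.1 ∈ coneTriangle e}

end TruncatedCone

end

/-!
A complete geodesic space is CAT(0) as soon as its metric satisfies Stewart's inequality along
geodesics. For the cone over a tree of diameter at most `π` this reduces to a planar inequality:
any three rays of such a cone form a tripod, which folds onto planar sectors. The truncated cone is
the preimage of a planar kite under the folding that records the distance to the tip and to the
ray through `p`, so it inherits closedness and convexity.

For the weak topology, the points `1 · e_ij` converge weakly as `j → ∞` to `(√2 / 2) · b_i`, their
common foot on the ray through `b_i`; these feet converge weakly to `½ · p` as `i → ∞`, and yet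
`1 · e_{i f(i)}` converges weakly to `o` for every choice of `f`. A weak neighbourhood of `½ · p`
therefore contains `1 · e_{i f(i)}` for all large `i` and a suitable `f`, and then it meets every
weak neighbourhood of `o`.

The barycentric coordinates of the triangulation are the hat functions attached to the vertices of
the tree; within one triangle they are linear and the Euclidean metric is read off from them.
-/

noncomputable section

/-! ### A criterion for CAT(0) spaces -/

section Stewart

variable {E : Type*} [NormedAddCommGroup E] [InnerProductSpace ℝ E]
variable {X : Type*} [MetricSpace X] {p q r x y m m' : X} {s t : ℝ}

theorem dist_sq_lineMap (p q r : E) (t : ℝ) :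
    dist p (AffineMap.lineMap q r t) ^ 2 =
      (1 - t) * dist p q ^ 2 + t * dist p r ^ 2 - t * (1 - t) * dist q r ^ 2 := by
  have hm : p - AffineMap.lineMap q r t = (1 - t) • (p - q) + t • (p - r) := by
    rw [AffineMap.lineMap_apply_module]; module
  have hqr : q - r = (p - r) - (p - q) := by abel
  simp only [dist_eq_norm, hm, hqr, norm_add_sq_real, norm_sub_sq_real (p - r), norm_smul,
    inner_smul_left, inner_smul_right, mul_pow, Real.norm_eq_abs, sq_abs,
    real_inner_comm (p - q) (p - r), conj_trivial]
  ring

/-- `m` satisfies the Bruhat–Tits inequality for the point that divides `[q, r]` in the ratio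
`t : 1 - t`: its distances from all points are at most those in Stewart's theorem in the plane. -/
def IsStewartPoint (q r : X) (t : ℝ) (m : X) : Prop :=
  ∀ p, dist p m ^ 2 ≤ (1 - t) * dist p q ^ 2 + t * dist p r ^ 2 - t * (1 - t) * dist q r ^ 2

namespace IsStewartPoint

theorem dist_left_le (h : IsStewartPoint q r t m) (ht : 0 ≤ t) : dist q m ≤ t * dist q r := by
  have hq := h q
  rw [dist_self] at hq
  exact le_of_sq_le_sq (by linarith) (mul_nonneg ht dist_nonneg)

theorem dist_right_le (h : IsStewartPoint q r t m) (ht : t ≤ 1) :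
    dist m r ≤ (1 - t) * dist q r := by
  have hr := h r
  rw [dist_self, dist_comm r q, dist_comm r m] at hr
  exact le_of_sq_le_sq (by linarith) (mul_nonneg (sub_nonneg.2 ht) dist_nonneg)

theorem dist_left (h : IsStewartPoint q r t m) (ht : t ∈ Set.Icc (0 : ℝ) 1) :
    dist q m = t * dist q r := by
  linarith [h.dist_left_le ht.1, h.dist_right_le ht.2, dist_triangle q m r]

theorem dist_right (h : IsStewartPoint q r t m) (ht : t ∈ Set.Icc (0 : ℝ) 1) :
    dist m r = (1 - t) * dist q r := by
  linarith [h.dist_left_le ht.1, h.dist_right_le ht.2, dist_triangle q m r]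

theorem dist_eq (h : IsStewartPoint q r s m) (h' : IsStewartPoint q r t m')
    (hs : s ∈ Set.Icc (0 : ℝ) 1) (ht : t ∈ Set.Icc (0 : ℝ) 1) :
    dist m m' = |s - t| * dist q r := by
  have hm := h' m
  rw [dist_comm m q, h.dist_left hs, h.dist_right hs] at hm
  apply le_antisymm
  · refine le_of_sq_le_sq ?_ (by positivity)
    rw [mul_pow, sq_abs]
    linarith
  · calc |s - t| * dist q r = |dist m q - dist m' q| := by
          rw [dist_comm m q, dist_comm m' q, h.dist_left hs, h'.dist_left ht, ← sub_mul, abs_mul,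
            abs_of_nonneg dist_nonneg]
      _ ≤ dist m m' := abs_dist_sub_le m m' q

theorem eq_of_dist (h : IsStewartPoint q r t m) (hl : dist q m' = t * dist q r)
    (hr : dist m' r = (1 - t) * dist q r) : m' = m := by
  have hm := h m'
  rw [dist_comm m' q, hl, hr] at hm
  exact dist_eq_zero.1 ((sq_nonpos_iff _).1 (by linarith))

/-- Both distances are bounded by applying Stewart's theorem twice, along `[p, r]` and along
`[p, q]`. -/
theorem dist_le_dist_lineMap (hx : IsStewartPoint p q s x) (hy : IsStewartPoint p r t y)
    (hs : s ∈ Set.Icc (0 : ℝ) 1) (ht : 0 ≤ t) {p' q' r' : E} (hpq : dist p' q' = dist p q)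
    (hpr : dist p' r' = dist p r) (hqr : dist q' r' = dist q r) :
    dist x y ≤ dist (AffineMap.lineMap p' q' s) (AffineMap.lineMap p' r' t) := by
  have hx' : dist (AffineMap.lineMap p' q' s) p' = dist x p := by
    rw [dist_lineMap_left, Real.norm_of_nonneg hs.1, hpq, dist_comm x, hx.dist_left hs]
  have hxr : dist x r ^ 2 ≤ dist (AffineMap.lineMap p' q' s) r' ^ 2 := by
    have h := hx r
    rw [dist_comm _ r', dist_comm x, dist_sq_lineMap, dist_comm r' p', dist_comm r' q', hpr, hqr,
      hpq]
    rwa [dist_comm r p, dist_comm r q] at h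
  refine le_of_sq_le_sq ((hy x).trans ?_) dist_nonneg
  rw [dist_sq_lineMap, hx', hpr]
  gcongr

end IsStewartPoint

theorem exists_isStewartPoint_of_mem_metricSegment
    (h : ∀ t ∈ Set.Icc (0 : ℝ) 1, ∃ m, IsStewartPoint q r t m) (hx : x ∈ metricSegment q r) :
    ∃ t ∈ Set.Icc (0 : ℝ) 1, IsStewartPoint q r t x := by
  have hx' : dist q x + dist x r = dist q r := hx
  obtain ⟨t, ht, hl⟩ : ∃ t ∈ Set.Icc (0 : ℝ) 1, dist q x = t * dist q r := by
    refine ⟨dist q x / dist q r, ⟨by positivity, div_le_one_of_le₀ ?_ dist_nonneg⟩, ?_⟩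
    · linarith [dist_nonneg (x := x) (y := r)]
    · rcases eq_or_ne (dist q r) 0 with h0 | h0
      · rw [h0, mul_zero]
        linarith [dist_nonneg (x := q) (y := x), dist_nonneg (x := x) (y := r)]
      · field_simp
  obtain ⟨m, hm⟩ := h t ht
  exact ⟨t, ht, hm.eq_of_dist hl (by linarith) ▸ hm⟩

theorem exists_isGeodesic_of_isStewartPoint {σ : ℝ → X}
    (hσ : ∀ t ∈ Set.Icc (0 : ℝ) 1, IsStewartPoint q r t (σ t)) :
    ∃ γ : ℝ → X, IsGeodesic γ (dist q r) ∧ γ 0 = q ∧ γ (dist q r) = r ∧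
      ∀ s ∈ Set.Icc 0 (dist q r), ∃ t ∈ Set.Icc (0 : ℝ) 1, γ s = σ t := by
  have e0 : σ 0 = q := ((hσ 0 (by simp)).eq_of_dist (by simp) (by simp)).symm
  have e1 : σ 1 = r := ((hσ 1 (by simp)).eq_of_dist (by simp) (by simp)).symm
  have hmem : ∀ s ∈ Set.Icc 0 (dist q r), s / dist q r ∈ Set.Icc (0 : ℝ) 1 := fun s hs =>
    ⟨div_nonneg hs.1 dist_nonneg, div_le_one_of_le₀ hs.2 dist_nonneg⟩
  refine ⟨fun s => σ (s / dist q r), ⟨dist_nonneg, fun s hs t ht => ?_⟩, by simp [e0], ?_,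
    fun s hs => ⟨_, hmem s hs, rfl⟩⟩
  · rw [(hσ _ (hmem s hs)).dist_eq (hσ _ (hmem t ht)) (hmem s hs) (hmem t ht), ← sub_div, abs_div,
      abs_of_nonneg dist_nonneg]
    refine div_mul_cancel_of_imp fun h0 => ?_
    rw [h0, Set.Icc_self, Set.mem_singleton_iff] at hs ht
    simp [hs, ht]
  · rcases eq_or_ne q r with rfl | hne
    · simp [e0]
    · simp [div_self (dist_pos.2 hne).ne', e1]

theorem isCAT0_of_isStewartPoint [CompleteSpace X]
    (h : ∀ q r : X, ∀ t ∈ Set.Icc (0 : ℝ) 1, ∃ m, IsStewartPoint q r t m) : IsCAT0 X where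
  complete := inferInstance
  geodesic q r := by
    have : Nonempty X := ⟨q⟩
    choose! σ hσ using h q r
    obtain ⟨γ, hγ, h0, h1, -⟩ := exists_isGeodesic_of_isStewartPoint hσ
    exact ⟨γ, hγ, h0, h1⟩
  comparison p q r x y p' q' r' x' y' hpq hpr hqr hx hpx hxq hy hpy hyr := by
    obtain ⟨s, hs, hsx⟩ := exists_isStewartPoint_of_mem_metricSegment (h p q) hx
    obtain ⟨t, ht, hty⟩ := exists_isStewartPoint_of_mem_metricSegment (h p r) hy
    have ex : x' = AffineMap.lineMap p' q' s := by
      apply eq_lineMap_of_dist_eq_mul_of_dist_eq_mul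
      · rw [hpx, hsx.dist_left hs, hpq]
      · rw [hxq, hsx.dist_right hs, hpq]
    have ey : y' = AffineMap.lineMap p' r' t := by
      apply eq_lineMap_of_dist_eq_mul_of_dist_eq_mul
      · rw [hpy, hty.dist_left ht, hpr]
      · rw [hyr, hty.dist_right ht, hpr]
    rw [ex, ey]
    exact hsx.dist_le_dist_lineMap hty hs ht.1 hpq hpr hqr

end Stewart

/-! ### Weak convergence -/

section WeakConvergence

variable {X : Type*} [MetricSpace X] {u : ℕ → X} {x y : X}

theorem weaklyConverges_of_dist_sq_le (hu : Bornology.IsBounded (Set.range u))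
    (h : ∀ z, ∀ᶠ n in Filter.atTop, dist (u n) x ^ 2 + dist x z ^ 2 ≤ dist (u n) z ^ 2) :
    WeaklyConverges u x := by
  refine ⟨hu, fun γ L hγ h0 q hq => Filter.tendsto_of_subseq_tendsto fun ns hns => ?_⟩
  have hx : x ∈ γ '' Set.Icc 0 L := ⟨0, ⟨le_rfl, hγ.1⟩, h0⟩
  obtain ⟨z, -, ms, hms, hz⟩ := hγ.isCompact_image.tendsto_subseq fun n => (hq (ns n)).1
  suffices x = z from ⟨ms, this ▸ hz⟩
  obtain ⟨R, hR⟩ := (Metric.isBounded_iff_subset_closedBall x).1 hu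
  have hle : ∀ᶠ n in Filter.atTop, dist x z ^ 2 ≤
      2 * R * dist (q (ns (ms n))) z + dist (q (ns (ms n))) z ^ 2 := by
    filter_upwards [(hns.comp hms.tendsto_atTop).eventually (h z)] with n hn
    set k := ns (ms n)
    replace hn : dist (u k) x ^ 2 + dist x z ^ 2 ≤ dist (u k) z ^ 2 := hn
    have huR : dist (u k) x ≤ R := hR ⟨k, rfl⟩
    have huz : dist (u k) z ≤ dist (u k) x + dist (q k) z :=
      (dist_triangle _ _ _).trans (add_le_add_left ((hq k).2 x hx) _)
    nlinarith [pow_le_pow_left₀ dist_nonneg huz 2, dist_nonneg (x := q k) (y := z)]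
  have hqz : Filter.Tendsto (fun n => dist (q (ns (ms n))) z) Filter.atTop (𝓝 0) :=
    tendsto_iff_dist_tendsto_zero.1 hz
  have hxz : dist x z ^ 2 ≤ 0 := by
    refine ge_of_tendsto ?_ hle
    simpa using (hqz.const_mul (2 * R)).add (hqz.pow 2)
  exact dist_eq_zero.1 ((sq_nonpos_iff _).1 hxz)

theorem WeaklyConverges.eventually_mem (h : WeaklyConverges u x) {U : Set X}
    (hU : IsOpen[weakTopology X] U) (hx : x ∈ U) : ∀ᶠ n in Filter.atTop, u n ∈ U := by
  by_contra hcon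
  obtain ⟨φ, hφ, hφU⟩ := Filter.extraction_of_frequently_atTop (Filter.not_eventually.1 hcon)
  have hclosed : IsWeaklyClosed Uᶜ := hU
  exact hclosed _ x hφU (h.comp hφ) hx

/-- A diagonal argument: every weak neighbourhood of `y` contains `u i` for large `i`, hence
`v i (f i)` for a suitable `f`, and these points converge to `x`. -/
theorem not_disjoint_weak_nhds {v : ℕ → ℕ → X} (hu : WeaklyConverges u y)
    (hv : ∀ i, WeaklyConverges (v i) (u i))
    (hdiag : ∀ f : ℕ → ℕ, WeaklyConverges (fun i => v i (f i)) x) :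
    ¬ ∃ U V : Set X, IsOpen[weakTopology X] U ∧ IsOpen[weakTopology X] V ∧
      x ∈ U ∧ y ∈ V ∧ Disjoint U V := by
  rintro ⟨U, V, hU, hV, hx, hy, hUV⟩
  have hex : ∀ i, ∃ j, u i ∈ V → v i j ∈ V := fun i => by
    by_cases hi : u i ∈ V
    · obtain ⟨j, hj⟩ := ((hv i).eventually_mem hV hi).exists
      exact ⟨j, fun _ => hj⟩
    · exact ⟨0, fun h => absurd h hi⟩
  choose f hf using hex
  obtain ⟨i, hiV, hiU⟩ :=
    ((hu.eventually_mem hV hy).and ((hdiag f).eventually_mem hU hx)).exists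
  exact Set.disjoint_left.1 hUV hiU (hf i hiV)

theorem not_t2Space_weakTopology (hxy : x ≠ y)
    (h : ¬ ∃ U V : Set X, IsOpen[weakTopology X] U ∧ IsOpen[weakTopology X] V ∧
      x ∈ U ∧ y ∈ V ∧ Disjoint U V) : ¬ @T2Space X (weakTopology X) := fun hT2 =>
  h ((@t2Space_iff X (weakTopology X)).1 hT2 hxy)

end WeakConvergence

/-! ### Euclidean complexes -/

theorem exists_last_mem_closed {X ι : Type*} [TopologicalSpace X] [DecidableEq ι] {γ : ℝ → X}
    {a b : ℝ} (hab : a ≤ b) (hγ : ContinuousOn γ (Set.Icc a b)) {F : Finset ι} {S : ι → Set X}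
    (hS : ∀ i ∈ F, IsClosed (S i)) (hcov : ∀ s ∈ Set.Icc a b, ∃ i ∈ F, γ s ∈ S i) {i : ι}
    (hi : i ∈ F) (ha : γ a ∈ S i) :
    ∃ c ∈ Set.Icc a b, γ c ∈ S i ∧ (c < b → ∀ s ∈ Set.Icc c b, ∃ j ∈ F.erase i, γ s ∈ S j) := by
  have hcompact : IsCompact (Set.Icc a b ∩ γ ⁻¹' S i) :=
    isCompact_Icc.of_isClosed_subset
      (hγ.preimage_isClosed_of_isClosed isClosed_Icc (hS i hi)) Set.inter_subset_left
  obtain ⟨c, ⟨hc, hci⟩, hmax⟩ := hcompact.exists_isGreatest ⟨a, ⟨le_rfl, hab⟩, ha⟩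
  refine ⟨c, hc, hci, fun hcb s hs => ?_⟩
  have hsub : Set.Icc c b ⊆ Set.Icc a b := Set.Icc_subset_Icc_left hc.1
  have hclosed : IsClosed (Set.Icc c b ∩ γ ⁻¹' ⋃ j ∈ F.erase i, S j) :=
    (hγ.mono hsub).preimage_isClosed_of_isClosed isClosed_Icc <|
      (F.erase i).finite_toSet.isClosed_biUnion fun j hj => hS j (Finset.mem_of_mem_erase hj)
  have hIoc : Set.Ioc c b ⊆ Set.Icc c b ∩ γ ⁻¹' ⋃ j ∈ F.erase i, S j := by
    intro t ht
    have ht' := Set.Ioc_subset_Icc_self ht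
    obtain ⟨j, hjF, hj⟩ := hcov t (hsub ht')
    refine ⟨ht', Set.mem_biUnion (Finset.mem_coe.2 (Finset.mem_erase.2 ⟨?_, hjF⟩)) hj⟩
    rintro rfl
    exact (hmax ⟨hsub ht', hj⟩).not_gt ht.1
  have hIcc := closure_minimal hIoc hclosed
  rw [closure_Ioc hcb.ne] at hIcc
  simpa only [Set.mem_preimage, Set.mem_iUnion₂, exists_prop] using (hIcc hs).2

namespace EuclideanComplex

variable {X : Type*} (C : EuclideanComplex X)

theorem zero_mem_stringLengths (x : X) : 0 ∈ C.stringLengths x x :=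
  ⟨0, fun _ => x, fun _ => ∅, rfl, rfl, by simp, by simp⟩

variable {C}

theorem add_mem_stringLengths {x y z : X} {s : Finset C.V} {l : ℝ} (hs : s ∈ C.K.faces)
    (hx : x ∈ C.closedSimplex s) (hy : y ∈ C.closedSimplex s) (hl : l ∈ C.stringLengths y z) :
    dist (C.position s x) (C.position s y) + l ∈ C.stringLengths x z := by
  obtain ⟨n, u, σ, rfl, rfl, h, rfl⟩ := hl
  refine ⟨n + 1, fun k => k.casesOn x u, fun k => k.casesOn s σ, rfl, rfl, ?_, ?_⟩
  · rintro (_ | i) hi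
    · exact ⟨hs, hx, hy⟩
    · exact h i (by omega)
  · rw [Finset.sum_range_succ', add_comm]
    rfl

variable [MetricSpace X]

variable (C) in
/-- The metric restricts on every closed simplex of the complex to the metric of the Euclidean
simplex attached to it. -/
def IsPiecewiseEuclidean : Prop :=
  ∀ s ∈ C.K.faces, ∀ x ∈ C.closedSimplex s, ∀ y ∈ C.closedSimplex s,
    dist (C.position s x) (C.position s y) = dist x y

theorem dist_le_of_mem_stringLengths (hdist : C.IsPiecewiseEuclidean) {x y : X} {l : ℝ}
    (hl : l ∈ C.stringLengths x y) : dist x y ≤ l := by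
  obtain ⟨n, z, s, rfl, rfl, hs, rfl⟩ := hl
  refine (dist_le_range_sum_dist z n).trans_eq (Finset.sum_congr rfl fun i hi => ?_)
  obtain ⟨hsi, hz, hz'⟩ := hs i (Finset.mem_range.1 hi)
  exact (hdist _ hsi _ hz _ hz').symm

theorem sub_mem_stringLengths (hdist : C.IsPiecewiseEuclidean) {γ : ℝ → X} {b : ℝ}
    (F : Finset (Finset C.V)) :
    ∀ a ≤ b, (∀ s ∈ F, s ∈ C.K.faces ∧ IsClosed (C.closedSimplex s)) →
      (∀ s ∈ Set.Icc a b, ∀ t ∈ Set.Icc a b, dist (γ s) (γ t) = |s - t|) →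
      (∀ s ∈ Set.Icc a b, ∃ σ ∈ F, γ s ∈ C.closedSimplex σ) →
      b - a ∈ C.stringLengths (γ a) (γ b) := by
  classical
  induction F using Finset.strongInduction with
  | H F ih =>
  intro a hab hF hγ hcov
  have hcont : ContinuousOn γ (Set.Icc a b) := LipschitzOnWith.continuousOn (K := 1) <|
    LipschitzOnWith.of_dist_le_mul fun s hs t ht => by simp [hγ s hs t ht, Real.dist_eq]
  obtain ⟨σ, hσF, haσ⟩ := hcov a ⟨le_rfl, hab⟩
  obtain ⟨c, hc, hcσ, hrest⟩ :=
    exists_last_mem_closed hab hcont (fun s hs => (hF s hs).2) hcov hσF haσ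
  have hac : dist (C.position σ (γ a)) (C.position σ (γ c)) = c - a := by
    rw [hdist σ (hF σ hσF).1 _ haσ _ hcσ, hγ a ⟨le_rfl, hab⟩ c hc, abs_sub_comm,
      abs_of_nonneg (sub_nonneg.2 hc.1)]
  have hcb : b - c ∈ C.stringLengths (γ c) (γ b) := by
    rcases eq_or_lt_of_le hc.2 with rfl | hlt
    · simpa using C.zero_mem_stringLengths (γ c)
    · have hsub : Set.Icc c b ⊆ Set.Icc a b := Set.Icc_subset_Icc_left hc.1
      exact ih _ (Finset.erase_ssubset hσF) c hlt.le
        (fun s hs => hF s (Finset.mem_of_mem_erase hs))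
        (fun s hs t ht => hγ s (hsub hs) t (hsub ht)) (hrest hlt)
  have := add_mem_stringLengths (hF σ hσF).1 haσ hcσ hcb
  rwa [hac, sub_add_sub_cancel'] at this

theorem inducesMetric_of_isGeodesic (hdist : C.IsPiecewiseEuclidean)
    (hgeod : ∀ x y : X, ∃ (γ : ℝ → X) (F : Finset (Finset C.V)), IsGeodesic γ (dist x y) ∧
      γ 0 = x ∧ γ (dist x y) = y ∧ (∀ s ∈ F, s ∈ C.K.faces ∧ IsClosed (C.closedSimplex s)) ∧
      ∀ t ∈ Set.Icc 0 (dist x y), ∃ s ∈ F, γ t ∈ C.closedSimplex s) :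
    C.InducesMetric := by
  refine fun x y => IsLeast.isGLB ⟨?_, fun l hl => dist_le_of_mem_stringLengths hdist hl⟩
  obtain ⟨γ, F, hγ, h0, h1, hF, hcov⟩ := hgeod x y
  have := sub_mem_stringLengths hdist F 0 hγ.1 hF hγ.2 hcov
  rwa [sub_zero, h0, h1] at this

end EuclideanComplex

/-! ### Polar coordinates in the plane -/

/-- The point of the plane with the polar coordinates `r` and `t`. -/
def ofPolar (r t : ℝ) : ℂ := r * Complex.exp (t * Complex.I)

section OfPolar

variable {a b r s t α δ : ℝ}

@[simp]
theorem ofPolar_re (r t : ℝ) : (ofPolar r t).re = r * Real.cos t := by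
  rw [ofPolar, Complex.re_ofReal_mul, Complex.exp_ofReal_mul_I_re]

@[simp]
theorem ofPolar_im (r t : ℝ) : (ofPolar r t).im = r * Real.sin t := by
  rw [ofPolar, Complex.im_ofReal_mul, Complex.exp_ofReal_mul_I_im]

theorem ofPolar_mul_exp (r s t : ℝ) :
    ofPolar r s * Complex.exp (t * Complex.I) = ofPolar r (s + t) := by
  rw [ofPolar, ofPolar, mul_assoc, ← Complex.exp_add]
  push_cast
  ring_nf

theorem norm_ofPolar (hr : 0 ≤ r) (t : ℝ) : ‖ofPolar r t‖ = r := by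
  rw [ofPolar, norm_mul, Complex.norm_exp_ofReal_mul_I, mul_one, Complex.norm_of_nonneg hr]

theorem ofPolar_norm_arg (z : ℂ) : ofPolar ‖z‖ z.arg = z := Complex.norm_mul_exp_arg_mul_I z

theorem dist_ofPolar (a b α β : ℝ) :
    dist (ofPolar a α) (ofPolar b β) = coneDist a b (α - β) := by
  rw [coneDist_eq_norm, dist_eq_norm]
  rfl

theorem lineMap_ofPolar (a b α β s : ℝ) :
    AffineMap.lineMap (ofPolar a α) (ofPolar b β) s =
      ofPolar ((1 - s) * a) α + ofPolar (s * b) β := by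
  simp only [AffineMap.lineMap_apply_module, ofPolar, Complex.real_smul]
  push_cast
  ring

theorem nonneg_of_ofPolar_im_nonneg (hr : 0 < r) (ht : -Real.pi < t) (h : 0 ≤ (ofPolar r t).im) :
    0 ≤ t := by
  by_contra! hneg
  rw [ofPolar_im] at h
  exact (mul_neg_of_pos_of_neg hr (Real.sin_neg_of_neg_of_neg_pi_lt hneg ht)).not_ge h

theorem nonpos_of_ofPolar_im_nonpos (hr : 0 < r) (ht : t < Real.pi) (h : (ofPolar r t).im ≤ 0) :
    t ≤ 0 := by
  by_contra! hpos
  rw [ofPolar_im] at h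
  exact (mul_pos hr (Real.sin_pos_of_pos_of_lt_pi hpos ht)).not_ge h

/-- Rotating the bisector of the two directions to the real axis moves the sum to the right half
plane, where its argument is controlled. -/
theorem exists_ofPolar_eq_add (ha : 0 ≤ a) (hb : 0 ≤ b) (hδ : δ ≤ α) (hα : α ≤ δ + Real.pi) :
    ∃ r : ℝ≥0, ∃ t ∈ Set.Icc δ α, ofPolar r t = ofPolar a α + ofPolar b δ := by
  set μ := (α + δ) / 2 with hμ
  set z := ofPolar a (α + -μ) + ofPolar b (δ + -μ) with hz
  have hrot : ∀ t, ofPolar ‖z‖ (z.arg + t) = ofPolar a (α + -μ + t) + ofPolar b (δ + -μ + t) :=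
    fun t => by
      rw [← ofPolar_mul_exp, ofPolar_norm_arg, hz, add_mul, ofPolar_mul_exp, ofPolar_mul_exp]
  have hsum : ofPolar ‖z‖ (z.arg + μ) = ofPolar a α + ofPolar b δ := by
    rw [hrot, neg_add_cancel_right, neg_add_cancel_right]
  rcases eq_or_ne z 0 with h0 | h0
  · refine ⟨0, δ, ⟨le_rfl, hδ⟩, ?_⟩
    rw [← hsum, h0]
    simp [ofPolar]
  have harg : |z.arg| ≤ Real.pi / 2 := by
    have hre : ∀ t, |t| ≤ Real.pi / 2 → 0 ≤ Real.cos t := fun t ht =>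
      Real.cos_nonneg_of_neg_pi_div_two_le_of_le (abs_le.1 ht).1 (abs_le.1 ht).2
    rw [Complex.abs_arg_le_pi_div_two_iff, hz, Complex.add_re, ofPolar_re, ofPolar_re]
    exact add_nonneg (mul_nonneg ha (hre _ (abs_le.2 ⟨by linarith, by linarith⟩)))
      (mul_nonneg hb (hre _ (abs_le.2 ⟨by linarith, by linarith⟩)))
  have hsin : 0 ≤ Real.sin (α - δ) :=
    Real.sin_nonneg_of_nonneg_of_le_pi (by linarith) (by linarith)
  have hδ' : 0 ≤ z.arg + (μ - δ) := by
    refine nonneg_of_ofPolar_im_nonneg (norm_pos_iff.2 h0)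
      (by linarith [(abs_le.1 harg).1, Real.pi_pos]) ?_
    have hα₀ : α + -μ + (μ - δ) = α - δ := by ring
    have hδ₀ : δ + -μ + (μ - δ) = 0 := by ring
    rw [hrot, hα₀, hδ₀, Complex.add_im, ofPolar_im, ofPolar_im, Real.sin_zero, mul_zero, add_zero]
    exact mul_nonneg ha hsin
  have hα' : z.arg + (μ - α) ≤ 0 := by
    refine nonpos_of_ofPolar_im_nonpos (norm_pos_iff.2 h0)
      (by linarith [(abs_le.1 harg).2, Real.pi_pos]) ?_
    have hα₀ : α + -μ + (μ - α) = 0 := by ring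
    have hδ₀ : δ + -μ + (μ - α) = -(α - δ) := by ring
    rw [hrot, hα₀, hδ₀, Complex.add_im, ofPolar_im, ofPolar_im, Real.sin_zero, mul_zero, zero_add,
      Real.sin_neg, mul_neg, neg_nonpos]
    exact mul_nonneg hb hsin
  exact ⟨‖z‖₊, z.arg + μ, ⟨by linarith, by linarith⟩, hsum⟩

end OfPolar

/-! ### Euclidean cones -/

section ConeDist

theorem coneDist_sq (a b θ : ℝ) : coneDist a b θ ^ 2 = a ^ 2 + b ^ 2 - 2 * a * b * Real.cos θ := by
  rw [coneDist, Real.sq_sqrt]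
  nlinarith [sq_nonneg (a - b * Real.cos θ), Real.sin_sq_add_cos_sq θ,
    sq_nonneg (b * Real.sin θ)]

theorem coneDist_nonneg (a b θ : ℝ) : 0 ≤ coneDist a b θ := Real.sqrt_nonneg _

theorem coneDist_abs (a b θ : ℝ) : coneDist a b |θ| = coneDist a b θ := by
  rw [coneDist, Real.cos_abs, coneDist]

theorem coneDist_self_zero (a : ℝ) : coneDist a a 0 = 0 := by
  rw [coneDist, Real.cos_zero, Real.sqrt_eq_zero'.2 (by linarith)]

theorem continuous_coneDist : Continuous fun x : ℝ × ℝ × ℝ => coneDist x.1 x.2.1 x.2.2 := by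
  unfold coneDist
  fun_prop

theorem abs_sub_le_coneDist {a b : ℝ} (ha : 0 ≤ a) (hb : 0 ≤ b) (θ : ℝ) :
    |a - b| ≤ coneDist a b θ := by
  refine abs_le_of_sq_le_sq ?_ (coneDist_nonneg _ _ _)
  rw [coneDist_sq]
  nlinarith [mul_le_mul_of_nonneg_left (Real.cos_le_one θ) (mul_nonneg ha hb)]

theorem mul_le_coneDist {a b m θ : ℝ} (hm : 0 ≤ m) (ha : m ≤ a) (hb : m ≤ b) (hθ : |θ| ≤ Real.pi) :
    2 * m / Real.pi * θ ≤ coneDist a b θ := by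
  refine le_of_sq_le_sq ?_ (coneDist_nonneg _ _ _)
  have hab : m * m ≤ a * b := mul_le_mul ha hb hm (hm.trans ha)
  have hcos : 2 / Real.pi ^ 2 * θ ^ 2 ≤ 1 - Real.cos θ := by
    linarith [Real.cos_le_one_sub_mul_cos_sq hθ]
  calc (2 * m / Real.pi * θ) ^ 2 = 2 * (m * m * (2 / Real.pi ^ 2 * θ ^ 2)) := by ring
    _ ≤ 2 * (a * b * (1 - Real.cos θ)) := by
      gcongr
      exact (mul_nonneg hm hm).trans hab
    _ ≤ coneDist a b θ ^ 2 := by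
      rw [coneDist_sq]
      linarith [sq_nonneg (a - b)]

end ConeDist

namespace ConeCoord

variable {Y : Type*} [MetricSpace Y]

theorem dist_def (x y : ConeCoord Y) :
    dist x y = coneDist x.radius y.radius (min Real.pi (dist x.direction y.direction)) := rfl

theorem abs_radius_sub_le_dist (x y : ConeCoord Y) : |(x.radius : ℝ) - y.radius| ≤ dist x y :=
  abs_sub_le_coneDist x.radius.2 y.radius.2 _

theorem continuous_mk : Continuous fun x : ℝ≥0 × Y => (⟨x.1, x.2⟩ : ConeCoord Y) := by
  refine continuous_iff_continuousAt.2 fun x => tendsto_iff_dist_tendsto_zero.2 ?_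
  have : Continuous fun z : ℝ≥0 × Y => coneDist z.1 x.1 (min Real.pi (dist z.2 x.2)) :=
    continuous_coneDist.comp (f := fun z : ℝ≥0 × Y =>
      ((z.1 : ℝ), (x.1 : ℝ), min Real.pi (dist z.2 x.2))) (by fun_prop)
  simpa [dist_def, Real.pi_pos.le, coneDist_self_zero] using this.tendsto x

theorem cauchySeq_direction {u : ℕ → ConeCoord Y} (hu : CauchySeq u) {m : ℝ} (hm : 0 < m)
    (hr : ∀ᶠ n in Filter.atTop, m ≤ (u n).radius) : CauchySeq fun n => (u n).direction := by
  have hpi := Real.pi_pos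
  obtain ⟨N₁, hN₁⟩ := Filter.eventually_atTop.1 hr
  refine Metric.cauchySeq_iff'.2 fun ε hε => ?_
  obtain ⟨N₂, hN₂⟩ := Metric.cauchySeq_iff.1 hu (2 * m / Real.pi * min Real.pi ε) (by positivity)
  refine ⟨max N₁ N₂, fun n hn => ?_⟩
  set N := max N₁ N₂
  set θ := min Real.pi (dist (u n).direction (u N).direction)
  have hθ : 2 * m / Real.pi * θ < 2 * m / Real.pi * min Real.pi ε :=
    (mul_le_coneDist hm.le (hN₁ n (le_of_max_le_left hn)) (hN₁ N (le_max_left _ _))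
      ((abs_of_nonneg (le_min hpi.le dist_nonneg)).trans_le (min_le_left _ _))).trans_lt
      (hN₂ n (le_of_max_le_right hn) N (le_max_right _ _))
  have hlt : θ < min Real.pi ε := lt_of_mul_lt_mul_left hθ (by positivity)
  rcases min_lt_iff.1 hlt with h | h
  · exact absurd h (min_le_left _ _).not_gt
  · exact h.trans_le (min_le_right _ _)

instance instCompleteSpace [CompleteSpace Y] : CompleteSpace (ConeCoord Y) := by
  refine Metric.complete_of_cauchySeq_tendsto fun u hu => ?_
  have hr : CauchySeq fun n => (u n).radius := by
    refine Metric.cauchySeq_iff'.2 fun ε hε => ?_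
    obtain ⟨N, hN⟩ := Metric.cauchySeq_iff'.1 hu ε hε
    exact ⟨N, fun n hn => (abs_radius_sub_le_dist _ _).trans_lt (hN n hn)⟩
  obtain ⟨R, hR⟩ := cauchySeq_tendsto_of_complete hr
  rcases eq_or_lt_of_le (zero_le (a := R)) with rfl | hpos
  · refine ⟨⟨0, (u 0).direction⟩, tendsto_iff_dist_tendsto_zero.2 ?_⟩
    have hdist : ∀ n, dist (u n) ⟨0, (u 0).direction⟩ = (u n).radius := fun n => by
      simp [dist_def, coneDist]
    simpa only [hdist, NNReal.coe_zero] using NNReal.tendsto_coe.2 hR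
  · have hbig : ∀ᶠ n in Filter.atTop, R / 2 ≤ (u n).radius :=
      (hR.eventually (lt_mem_nhds (NNReal.half_lt_self hpos.ne'))).mono fun _ h => h.le
    have hm : (0 : ℝ) < R / 2 := half_pos hpos
    obtain ⟨y, hy⟩ := cauchySeq_tendsto_of_complete
      (cauchySeq_direction hu hm (hbig.mono fun n h => by exact_mod_cast h))
    exact ⟨⟨R, y⟩, (continuous_mk.tendsto (R, y)).comp (hR.prodMk_nhds hy)⟩

end ConeCoord

namespace EuclideanCone

variable {Y : Type*} [MetricSpace Y] {a b l l' r s ρ : ℝ≥0} {c d v w y z : Y}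

theorem dist_point (r s : ℝ≥0) (y z : Y) :
    dist (point r y) (point s z) = coneDist r s (min Real.pi (dist y z)) := rfl

theorem dist_point_zero (r : ℝ≥0) (y z : Y) : dist (point r y) (point 0 z) = r := by
  simp [dist_point, coneDist]

theorem exists_eq_point (x : EuclideanCone Y) : ∃ r y, x = point r y := by
  obtain ⟨⟨r, y⟩, rfl⟩ := SeparationQuotient.surjective_mk x
  exact ⟨r, y, rfl⟩

theorem point_eq_point_iff : point r y = point s z ↔ r = s ∧ (r = 0 ∨ y = z) := by
  constructor
  · intro h
    have h0 : coneDist r s (min Real.pi (dist y z)) = 0 := by rw [← dist_point, h, dist_self]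
    have hrs : |(r : ℝ) - s| ≤ 0 := h0 ▸ abs_sub_le_coneDist r.2 s.2 _
    obtain rfl : r = s := NNReal.coe_injective (sub_eq_zero.1 (abs_nonpos_iff.1 hrs))
    refine ⟨rfl, or_iff_not_imp_left.2 fun hr => ?_⟩
    have hcos : Real.cos (min Real.pi (dist y z)) = 1 := by
      have hsq := coneDist_sq r r (min Real.pi (dist y z))
      have hr2 : (r : ℝ) ^ 2 ≠ 0 := pow_ne_zero 2 (NNReal.coe_ne_zero.2 hr)
      rw [h0] at hsq
      exact mul_left_cancel₀ hr2 (by linarith)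
    have hmin : min Real.pi (dist y z) = 0 := by
      have hpi := Real.pi_pos
      have h0 : 0 ≤ min Real.pi (dist y z) := le_min hpi.le dist_nonneg
      refine (Real.cos_eq_one_iff_of_lt_of_lt ?_ ?_).1 hcos
      · linarith
      · linarith [min_le_left Real.pi (dist y z)]
    rcases min_choice Real.pi (dist y z) with h | h
    · exact absurd (h.symm.trans hmin) Real.pi_ne_zero
    · exact dist_eq_zero.1 (h.symm.trans hmin)
  · rintro ⟨rfl, rfl | rfl⟩
    · refine dist_eq_zero.1 ?_
      simp [dist_point, coneDist]
    · rfl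

theorem continuous_point : Continuous fun x : ℝ≥0 × Y => point x.1 x.2 :=
  SeparationQuotient.continuous_mk.comp ConeCoord.continuous_mk

theorem dist_ofPolar_min_le (x x' : ConeCoord Y) (y₀ : Y) :
    dist (ofPolar x.radius (min Real.pi (dist x.direction y₀)))
      (ofPolar x'.radius (min Real.pi (dist x'.direction y₀))) ≤ dist x x' := by
  rw [dist_ofPolar, ← coneDist_abs, ConeCoord.dist_def]
  refine coneDist_mono x.radius.2 x'.radius.2 (abs_nonneg _) (le_min ?_ ?_) (min_le_left _ _)
  · rw [abs_le]
    constructor <;>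
      linarith [min_le_left Real.pi (dist x.direction y₀),
        min_le_left Real.pi (dist x'.direction y₀),
        le_min Real.pi_pos.le (dist_nonneg (x := x.direction) (y := y₀)),
        le_min Real.pi_pos.le (dist_nonneg (x := x'.direction) (y := y₀))]
  · refine (abs_min_sub_min_le_max _ _ _ _).trans (max_le ?_ (abs_dist_sub_le _ _ _))
    rw [sub_self, abs_zero]
    exact dist_nonneg

/-- The map of the cone to the plane with the polar coordinates `r` and `min π (dist y y₀)` at
`r · y`; it folds the cone along the ray in the direction `y₀`. -/
def fold (y₀ : Y) : EuclideanCone Y → ℂ :=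
  SeparationQuotient.lift (fun x => ofPolar x.radius (min Real.pi (dist x.direction y₀)))
    fun x x' h => dist_le_zero.1 ((dist_ofPolar_min_le x x' y₀).trans_eq
      (Metric.inseparable_iff.1 h))

theorem fold_point (y₀ : Y) (r : ℝ≥0) (y : Y) :
    fold y₀ (point r y) = ofPolar r (min Real.pi (dist y y₀)) := rfl

theorem continuous_fold (y₀ : Y) : Continuous (fold y₀) := by
  refine (LipschitzWith.of_dist_le_mul (K := 1) fun x x' => ?_).continuous
  obtain ⟨x, rfl⟩ := SeparationQuotient.surjective_mk x
  obtain ⟨x', rfl⟩ := SeparationQuotient.surjective_mk x'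
  rw [NNReal.coe_one, one_mul]
  exact dist_ofPolar_min_le x x' y₀

theorem dist_point_of_le_pi (hπ : ∀ y z : Y, dist y z ≤ Real.pi) (r s : ℝ≥0)
    (y z : Y) : dist (point r y) (point s z) = coneDist r s (dist y z) := by
  rw [dist_point, min_eq_right (hπ y z)]

theorem dist_point_sq_add_le (hπ : ∀ y z : Y, dist y z ≤ Real.pi)
    (hl : (l' : ℝ) = l * Real.cos (dist y v)) (hyw : dist y w = dist y v + dist v w) :
    dist (point l y) (point l' v) ^ 2 + dist (point l' v) (point r w) ^ 2 ≤
      dist (point l y) (point r w) ^ 2 := by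
  have hsin : ∀ y z : Y, 0 ≤ Real.sin (dist y z) := fun y z =>
    Real.sin_nonneg_of_nonneg_of_le_pi dist_nonneg (hπ y z)
  have hmul : 0 ≤ l * r * (Real.sin (dist y v) * Real.sin (dist v w)) :=
    mul_nonneg (mul_nonneg l.2 r.2) (mul_nonneg (hsin y v) (hsin v w))
  simp only [dist_point_of_le_pi hπ, coneDist_sq, hyw, hl, Real.cos_add]
  linarith

/-- Eventually the geodesics from `y n` to any given direction pass through `v`, so that `l' · v`
is the foot of the perpendicular from `l · y n`. -/
theorem weaklyConverges_of_dist_eq_add (hπ : ∀ y z : Y, dist y z ≤ Real.pi)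
    {P : EuclideanCone Y → Prop} {u : ℕ → {x // P x}} {x : {x // P x}} {y : ℕ → Y} {θ : ℝ}
    (hu : ∀ n, (u n).1 = point l (y n)) (hx : x.1 = point l' v) (hl : (l' : ℝ) = l * Real.cos θ)
    (hyv : ∀ n, dist (y n) v = θ)
    (hyw : ∀ w, ∀ᶠ n in Filter.atTop, dist (y n) w = θ + dist v w) : WeaklyConverges u x := by
  refine weaklyConverges_of_dist_sq_le ?_ ?_
  · refine Metric.isBounded_closedBall (x := x) (r := coneDist l l' θ) |>.subset ?_
    rintro - ⟨n, rfl⟩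
    rw [Metric.mem_closedBall, Subtype.dist_eq, hu, hx, dist_point_of_le_pi hπ, hyv]
  · rintro ⟨z, -⟩
    obtain ⟨r, w, rfl⟩ := exists_eq_point z
    filter_upwards [hyw w] with n hn
    simp only [Subtype.dist_eq, hu, hx]
    exact dist_point_sq_add_le hπ (by rw [hyv, hl]) (by rw [hyv, hn])

end EuclideanCone

/-- The four-point condition, which says that the metric space is `0`-hyperbolic in the sense of
Gromov, that is, a subspace of a metric tree. -/
def IsZeroHyperbolic (Y : Type*) [PseudoMetricSpace Y] : Prop :=
  ∀ v w y z : Y, dist v w + dist y z ≤ max (dist v y + dist w z) (dist v z + dist w y)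

namespace IsZeroHyperbolic

variable {Y : Type*} [MetricSpace Y] {a b ρ : ℝ≥0} {c d w : Y} {s α δ ψ : ℝ}

/-- The angle `χ` unfolds the tripod with the ends `c`, `d` and `v` into the line, keeping the
longer of the two distances to `c` and `d` that the four-point condition singles out. -/
theorem exists_angle (hY : IsZeroHyperbolic Y) (hπ : ∀ y z : Y, dist y z ≤ Real.pi)
    (hδψ : δ ≤ ψ) (hψα : ψ ≤ α) (hcd : dist c d = α - δ) (hwc : dist w c = α - ψ)
    (hwd : dist w d = ψ - δ) (v : Y) :
    ∃ χ, dist v w ≤ |χ - ψ| ∧ |χ - ψ| ≤ Real.pi ∧ |χ - α| ≤ dist v c ∧ |χ - δ| ≤ dist v d := by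
  have h := hY v w c d
  rw [hcd, hwc, hwd, le_max_iff] at h
  have hv := dist_nonneg (x := v) (y := w)
  rcases h with h | h
  · have hχ : |α - dist v c - ψ| = dist v c - (α - ψ) := by
      rw [abs_of_nonpos (by linarith)]
      ring
    refine ⟨α - dist v c, ?_, ?_, ?_, ?_⟩
    · linarith
    · linarith [hπ v c]
    · rw [sub_sub_cancel_left, abs_neg, abs_of_nonneg dist_nonneg]
    · rw [sub_right_comm, ← hcd, dist_comm v c, dist_comm c d, dist_comm v d, dist_comm c v]
      linarith [abs_dist_sub_le d v c]
  · have hχ : |δ + dist v d - ψ| = dist v d - (ψ - δ) := by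
      rw [abs_of_nonneg (by linarith)]
      ring
    refine ⟨δ + dist v d, ?_, ?_, ?_, ?_⟩
    · linarith
    · linarith [hπ v d]
    · have hvc : δ + dist v d - α = dist v d - dist c d := by
        rw [hcd]
        ring
      exact hvc ▸ abs_dist_sub_le v c d
    · rw [add_sub_cancel_left, abs_of_nonneg dist_nonneg]

theorem isStewartPoint (hY : IsZeroHyperbolic Y) (hπ : ∀ y z : Y, dist y z ≤ Real.pi)
    (hδψ : δ ≤ ψ) (hψα : ψ ≤ α) (hcd : dist c d = α - δ) (hwc : dist w c = α - ψ)
    (hwd : dist w d = ψ - δ) (hs : s ∈ Set.Icc (0 : ℝ) 1)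
    (hρ : ofPolar ρ ψ = AffineMap.lineMap (ofPolar a α) (ofPolar b δ) s) :
    IsStewartPoint (EuclideanCone.point a c) (EuclideanCone.point b d) s
      (EuclideanCone.point ρ w) := by
  intro p
  obtain ⟨l, v, rfl⟩ := p.exists_eq_point
  obtain ⟨χ, hw, hle, hc, hd⟩ := hY.exists_angle hπ hδψ hψα hcd hwc hwd v
  have hplane := dist_sq_lineMap (ofPolar l χ) (ofPolar a α) (ofPolar b δ) s
  simp only [← hρ, dist_ofPolar, ← hcd] at hplane
  simp only [EuclideanCone.dist_point_of_le_pi hπ]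
  have hmono : ∀ {x : ℝ≥0} {θ θ' : ℝ}, |θ| ≤ θ' → θ' ≤ Real.pi →
      coneDist l x θ ^ 2 ≤ coneDist l x θ' ^ 2 := fun {x θ θ'} h h' => by
    rw [← coneDist_abs l x θ]
    exact pow_le_pow_left₀ (coneDist_nonneg _ _ _) (coneDist_mono l.2 x.2 (abs_nonneg _) h h') 2
  have hm : coneDist l ρ (dist v w) ^ 2 ≤ coneDist l ρ (χ - ψ) ^ 2 := by
    rw [← coneDist_abs l ρ (χ - ψ)]
    exact hmono (by rwa [abs_of_nonneg dist_nonneg]) hle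
  have hs' := sub_nonneg.2 hs.2
  linarith [mul_le_mul_of_nonneg_left (hmono (x := a) hc (hπ v c)) hs',
    mul_le_mul_of_nonneg_left (hmono (x := b) hd (hπ v d)) hs.1]

end IsZeroHyperbolic

/-! ### The tree -/

namespace TreeCoord

variable {c d w : TreeCoord}

theorem dist_def (c d : TreeCoord) : dist c d = c.t + d.t - 2 * meet c d := rfl

theorem t_nonneg (c : TreeCoord) : 0 ≤ (c.t : ℝ) := c.t.2.1

theorem t_le (c : TreeCoord) : (c.t : ℝ) ≤ Real.pi / 2 := c.t.2.2

theorem meet_comm (c d : TreeCoord) : meet c d = meet d c := by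
  simp only [meet, overlap_comm c d, min_comm (c.t : ℝ) d.t]

theorem overlap_nonneg (c d : TreeCoord) : 0 ≤ overlap c d := by
  have := Real.pi_pos
  unfold overlap
  split_ifs <;> linarith

theorem meet_nonneg (c d : TreeCoord) : 0 ≤ meet c d :=
  le_min (le_min c.t_nonneg d.t_nonneg) (overlap_nonneg c d)

theorem meet_le_left (c d : TreeCoord) : meet c d ≤ c.t := (min_le_left _ _).trans (min_le_left _ _)

theorem meet_le_right (c d : TreeCoord) : meet c d ≤ d.t :=
  (min_le_left _ _).trans (min_le_right _ _)

theorem meet_le_overlap (c d : TreeCoord) : meet c d ≤ overlap c d := min_le_right _ _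

theorem min_meet_le (c d w : TreeCoord) : min (meet c d) (meet d w) ≤ meet c w := by
  have h := overlap_ultra c d w
  simp only [meet, le_min_iff]
  refine ⟨⟨?_, ?_⟩, le_trans (le_min ?_ ?_) h⟩ <;> simp

theorem meet_eq_zero_of_ne (h : c.i ≠ d.i) : meet c d = 0 := by
  refine le_antisymm ((meet_le_overlap c d).trans ?_) (meet_nonneg c d)
  simp [overlap, h]

theorem meet_eq_of_le (hi : w.i = c.i) (hj : w.j = c.j) (hm : meet c d ≤ w.t)
    (hw : (w.t : ℝ) ≤ c.t) : meet w d = meet c d := by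
  have hov : overlap w d = overlap c d := by simp only [overlap, hi, hj]
  refine le_antisymm (le_min (le_min ((meet_le_left w d).trans hw) (meet_le_right w d)) ?_)
    (le_min (le_min hm (meet_le_right c d)) ?_)
  · exact hov ▸ meet_le_overlap w d
  · exact hov ▸ meet_le_overlap c d

/-- The paths from the centre to two points separate at the centre or at an end of one of the first
edges, unless one of them contains the other. -/
theorem meet_mem (c d : TreeCoord) :
    meet c d = c.t ∨ meet c d = d.t ∨ meet c d = 0 ∨ meet c d = Real.pi / 4 := by
  have hc := c.t_le
  simp only [meet, overlap]
  grind

theorem dist_le_pi (c d : TreeCoord) : dist c d ≤ Real.pi := by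
  rw [dist_def]
  linarith [c.t_le, d.t_le, meet_nonneg c d]

theorem abs_t_sub_le_dist (c d : TreeCoord) : |(c.t : ℝ) - d.t| ≤ dist c d := by
  rw [dist_def, abs_le]
  constructor <;> linarith [meet_le_left c d, meet_le_right c d]

theorem dist_eq_abs_of_le_overlap (h : min (c.t : ℝ) d.t ≤ overlap c d) :
    dist c d = |(c.t : ℝ) - d.t| := by
  rw [dist_def, meet, min_eq_left h, ← max_sub_min_eq_abs' (c.t : ℝ) d.t]
  linarith [min_add_max (c.t : ℝ) d.t]

theorem dist_eq_abs_of_eq (hi : c.i = d.i) (hj : c.j = d.j) : dist c d = |(c.t : ℝ) - d.t| := by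
  refine dist_eq_abs_of_le_overlap ?_
  simpa only [overlap, hi, hj, if_true] using (min_le_left _ _).trans c.t_le

theorem dist_eq_zero_iff : dist c d = 0 ↔ (c.t : ℝ) = d.t ∧ (c.t : ℝ) ≤ overlap c d := by
  constructor
  · intro h
    rw [dist_def] at h
    have hc := meet_le_left c d
    have hd := meet_le_right c d
    exact ⟨by linarith, by linarith [meet_le_overlap c d]⟩
  · rintro ⟨h, h'⟩
    rw [dist_eq_abs_of_le_overlap ((min_le_left _ _).trans h'), h, sub_self, abs_zero]

theorem isZeroHyperbolic : IsZeroHyperbolic TreeCoord := by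
  intro v w y z
  simp only [dist_def]
  have h₁ := min_meet_le v y w
  have h₂ := min_meet_le v z w
  have h₃ := min_meet_le y v z
  have h₄ := min_meet_le y w z
  rw [meet_comm y w] at h₁ h₄
  rw [meet_comm z w] at h₂
  rw [meet_comm y v] at h₃
  grind

theorem exists_mem_path_left {ψ : ℝ} (h₀ : 0 ≤ ψ) (h : ψ ≤ c.t - meet c d) :
    ∃ w : TreeCoord, w.i = c.i ∧ w.j = c.j ∧ (w.t : ℝ) = meet c d + ψ ∧
      dist w c = c.t - meet c d - ψ ∧ dist w d = d.t - meet c d + ψ := by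
  have hm := meet_nonneg c d
  obtain ⟨w, hi, hj, ht⟩ : ∃ w : TreeCoord, w.i = c.i ∧ w.j = c.j ∧ (w.t : ℝ) = meet c d + ψ :=
    ⟨⟨c.i, c.j, meet c d + ψ, by linarith, by linarith [c.t_le]⟩, rfl, rfl, rfl⟩
  refine ⟨w, hi, hj, ht, ?_, ?_⟩
  · rw [dist_eq_abs_of_eq hi hj, abs_of_nonpos (by linarith), ht]
    ring
  · rw [dist_def, meet_eq_of_le hi hj (by linarith) (by linarith), ht]
    ring

theorem exists_mem_path {ψ : ℝ} (hd : -(d.t - meet c d) ≤ ψ) (hc : ψ ≤ c.t - meet c d) :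
    ∃ w : TreeCoord, (w.i = c.i ∧ w.j = c.j ∨ w.i = d.i ∧ w.j = d.j) ∧
      (w.t : ℝ) = meet c d + |ψ| ∧ dist w c = c.t - meet c d - ψ ∧
      dist w d = d.t - meet c d + ψ := by
  rcases le_total 0 ψ with h | h
  · obtain ⟨w, hi, hj, ht, hwc, hwd⟩ := exists_mem_path_left h hc
    exact ⟨w, Or.inl ⟨hi, hj⟩, by rw [ht, abs_of_nonneg h], hwc, hwd⟩
  · rw [meet_comm c d] at hd ⊢
    obtain ⟨w, hi, hj, ht, hwd, hwc⟩ := exists_mem_path_left (neg_nonneg.2 h) (neg_le.1 hd)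
    exact ⟨w, Or.inr ⟨hi, hj⟩, by rw [ht, abs_of_nonpos h], by linarith, by linarith⟩

/-- The overlaps take only finitely many values. -/
theorem eventually_le_overlap (T : ℝ) :
    ∀ᶠ x in 𝓝 T, ∀ c d : TreeCoord, x ≤ overlap c d → T ≤ overlap c d := by
  have key : ∀ a, ∀ᶠ x in 𝓝 T, x ≤ a → T ≤ a := fun a => by
    rcases le_or_gt T a with h | h
    · exact .of_forall fun _ _ => h
    · exact (lt_mem_nhds h).mono fun x hx hxa => absurd hxa hx.not_ge
  filter_upwards [key (Real.pi / 2), key (Real.pi / 4), key 0] with x h₁ h₂ h₃ c d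
  unfold overlap
  split_ifs <;> assumption

instance instCompleteSpace : CompleteSpace TreeCoord := by
  refine Metric.complete_of_cauchySeq_tendsto fun u hu => ?_
  have ht : CauchySeq fun n => (u n).t := by
    refine Metric.cauchySeq_iff'.2 fun ε hε => ?_
    obtain ⟨N, hN⟩ := Metric.cauchySeq_iff'.1 hu ε hε
    exact ⟨N, fun n hn => (abs_t_sub_le_dist _ _).trans_lt (hN n hn)⟩
  obtain ⟨T, hT⟩ := cauchySeq_tendsto_of_complete ht
  have hmeet : Filter.Tendsto (fun n : ℕ × ℕ => meet (u n.1) (u n.2)) Filter.atTop (𝓝 T) := by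
    have hT' := (continuous_subtype_val.tendsto T).comp hT
    rw [← Filter.prod_atTop_atTop_eq]
    have hdist := cauchySeq_iff_tendsto_dist_atTop_0.1 hu
    rw [← Filter.prod_atTop_atTop_eq] at hdist
    have h := (((hT'.comp Filter.tendsto_fst).add (hT'.comp Filter.tendsto_snd)).sub
      hdist).div_const 2
    rw [sub_zero, add_self_div_two] at h
    refine h.congr fun n => ?_
    simp only [Function.comp_apply, dist_def]
    ring
  obtain ⟨⟨M, N⟩, hMN⟩ := Filter.eventually_atTop.1 (hmeet.eventually (eventually_le_overlap T))
  refine ⟨⟨(u N).i, (u N).j, T⟩, ?_⟩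
  rw [tendsto_iff_dist_tendsto_zero] at hT ⊢
  refine hT.congr' ?_
  filter_upwards [Filter.eventually_ge_atTop M] with n hn
  have hov : (T : ℝ) ≤ overlap (u n) (u N) := hMN (n, N) ⟨hn, le_rfl⟩ _ _ (meet_le_overlap _ _)
  exact (dist_eq_abs_of_le_overlap (d := ⟨(u N).i, (u N).j, T⟩)
    ((min_le_right _ _).trans hov)).symm

/-- The coordinates `(0, 0, 0)` of the centre of the tree. -/
def center : TreeCoord := ⟨0, 0, 0, le_rfl, by positivity⟩

theorem dist_center (c : TreeCoord) : dist c center = c.t := by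
  have h : meet c center = 0 := le_antisymm (meet_le_right c center) (meet_nonneg c center)
  rw [dist_def, h, mul_zero, sub_zero]
  exact add_zero _

end TreeCoord

namespace ConeTree

theorem dist_le_pi (y z : ConeTree) : dist y z ≤ Real.pi := by
  obtain ⟨c, rfl⟩ := SeparationQuotient.surjective_mk y
  obtain ⟨d, rfl⟩ := SeparationQuotient.surjective_mk z
  exact TreeCoord.dist_le_pi c d

theorem isZeroHyperbolic : IsZeroHyperbolic ConeTree := by
  intro v w y z
  obtain ⟨v, rfl⟩ := SeparationQuotient.surjective_mk v
  obtain ⟨w, rfl⟩ := SeparationQuotient.surjective_mk w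
  obtain ⟨y, rfl⟩ := SeparationQuotient.surjective_mk y
  obtain ⟨z, rfl⟩ := SeparationQuotient.surjective_mk z
  exact TreeCoord.isZeroHyperbolic v w y z

end ConeTree

/-! ### The triangles -/

theorem modelTriangle_eq : modelTriangle = convexHull ℝ {0, 2, ⟨√2, √2⟩} := by
  have h : 2 * Complex.exp ((Real.pi / 4 : ℝ) * Complex.I) = ⟨√2, √2⟩ := by
    change ofPolar 2 _ = _
    apply Complex.ext
    · rw [ofPolar_re, Real.cos_pi_div_four, mul_div_cancel₀ _ two_ne_zero]
    · rw [ofPolar_im, Real.sin_pi_div_four, mul_div_cancel₀ _ two_ne_zero]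
  rw [modelTriangle, h]

theorem one_lt_sqrt_two : 1 < √2 := by
  rw [Real.lt_sqrt] <;> norm_num

theorem sqrt_two_lt_two : √2 < 2 := by
  rw [Real.sqrt_lt'] <;> norm_num

theorem convex_setOf_im_le_re :
    Convex ℝ {z : ℂ | 0 ≤ z.im ∧ z.im ≤ z.re ∧ z.re + (√2 - 1) * z.im ≤ 2} := by
  rintro u ⟨u₁, u₂, u₃⟩ v ⟨v₁, v₂, v₃⟩ a b ha hb hab
  simp only [Set.mem_ofPred_eq, Complex.add_im, Complex.add_re, Complex.smul_re,
    Complex.smul_im, smul_eq_mul]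
  refine ⟨by positivity, by gcongr, ?_⟩
  calc a * u.re + b * v.re + (√2 - 1) * (a * u.im + b * v.im)
      = a * (u.re + (√2 - 1) * u.im) + b * (v.re + (√2 - 1) * v.im) := by ring
    _ ≤ a * 2 + b * 2 := by gcongr
    _ = 2 := by rw [← add_mul, hab, one_mul]

theorem mem_modelTriangle_iff {z : ℂ} :
    z ∈ modelTriangle ↔ 0 ≤ z.im ∧ z.im ≤ z.re ∧ z.re + (√2 - 1) * z.im ≤ 2 := by
  have h2 : √2 * √2 = 2 := Real.mul_self_sqrt zero_le_two
  rw [modelTriangle_eq]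
  constructor
  · refine fun h => convexHull_min ?_ convex_setOf_im_le_re h
    rintro w (rfl | rfl | rfl)
    · simp
    · simp
    · exact ⟨Real.sqrt_nonneg 2, le_rfl, by linarith⟩
  · rintro ⟨h₁, h₂, h₃⟩
    have hv : 0 ≤ z.im * √2 / 2 := by positivity
    have hmem := (convex_convexHull ℝ {(0 : ℂ), 2, ⟨√2, √2⟩}).sum_mem (t := Finset.univ)
      (w := ![1 - ((z.re - z.im) / 2 + z.im * √2 / 2), (z.re - z.im) / 2, z.im * √2 / 2])
      (z := ![(0 : ℂ), 2, ⟨√2, √2⟩])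
      (fun i _ => by fin_cases i <;> simp <;> linarith)
      (by simp [Fin.sum_univ_three]; ring)
      (fun i _ => subset_convexHull ℝ _ (by fin_cases i <;> simp))
    convert hmem using 1
    apply Complex.ext
    · simp [Fin.sum_univ_three]
      linear_combination (-z.im / 2) * h2
    · simp [Fin.sum_univ_three]
      linear_combination (-z.im / 2) * h2

theorem sin_mem_Icc_zero_cos {t : ℝ} (ht : t ∈ Set.Icc 0 (Real.pi / 4)) :
    Real.sin t ∈ Set.Icc 0 (Real.cos t) := by
  have hπ := Real.pi_pos
  refine ⟨Real.sin_nonneg_of_nonneg_of_le_pi ht.1 (by linarith [ht.2]), ?_⟩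
  rw [← Real.cos_pi_div_two_sub]
  exact Real.cos_le_cos_of_nonneg_of_le_pi ht.1 (by linarith [ht.1]) (by linarith [ht.2])

theorem ofPolar_mem_modelTriangle_iff {r t : ℝ} (hr : 0 ≤ r)
    (ht : t ∈ Set.Icc 0 (Real.pi / 4)) :
    ofPolar r t ∈ modelTriangle ↔ r * Real.cos t + (√2 - 1) * (r * Real.sin t) ≤ 2 := by
  rw [mem_modelTriangle_iff, ofPolar_re, ofPolar_im]
  obtain ⟨h₀, h₁⟩ := sin_mem_Icc_zero_cos ht
  exact ⟨fun h => h.2.2, fun h => ⟨by positivity, by gcongr, h⟩⟩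

/-- The quadrilateral with the vertices `0`, `2`, `2 exp (i π / 4)`, `2 i` (without the two sides at
`0`, which play no role here): the truncated cone is its preimage under folding along the centre of
the tree. -/
def modelKite : Set ℂ :=
  {z | z.re + (√2 - 1) * z.im ≤ 2 ∧ (√2 - 1) * z.re + z.im ≤ 2}

theorem isClosed_modelKite : IsClosed modelKite :=
  (isClosed_le (f := fun z : ℂ => z.re + (√2 - 1) * z.im) (by fun_prop) continuous_const).inter
    (isClosed_le (f := fun z : ℂ => (√2 - 1) * z.re + z.im) (by fun_prop) continuous_const)

theorem mem_modelKite_iff_of_im_le_re {z : ℂ} (h : z.im ≤ z.re) :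
    z ∈ modelKite ↔ z.re + (√2 - 1) * z.im ≤ 2 :=
  and_iff_left_of_imp fun _ => by nlinarith [sqrt_two_lt_two]

theorem mem_modelKite_iff_of_re_le_im {z : ℂ} (h : z.re ≤ z.im) :
    z ∈ modelKite ↔ (√2 - 1) * z.re + z.im ≤ 2 :=
  and_iff_right_of_imp fun _ => by nlinarith [sqrt_two_lt_two]

theorem ofPolar_mem_modelKite_of_le_one {r t : ℝ} (hr₀ : 0 ≤ r) (hr : r ≤ 1) :
    ofPolar r t ∈ modelKite := by
  have h2 := sqrt_two_lt_two
  have h1 := one_lt_sqrt_two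
  have hre : r * Real.cos t ≤ 1 :=
    (mul_le_of_le_one_right hr₀ (Real.cos_le_one t)).trans hr
  have him : r * Real.sin t ≤ 1 :=
    (mul_le_of_le_one_right hr₀ (Real.sin_le_one t)).trans hr
  exact ⟨by rw [ofPolar_re, ofPolar_im]; nlinarith, by rw [ofPolar_re, ofPolar_im]; nlinarith⟩

namespace TreeCoord

/-- The point of the tree with given coordinates. -/
abbrev toTree (c : TreeCoord) : ConeTree := SeparationQuotient.mk c

theorem dist_toTree_p (c : TreeCoord) : dist c.toTree ConeTree.p = c.t := dist_center c

/-- An edge of the tree that contains the point with given coordinates. -/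
def edge (c : TreeCoord) : TreeEdge :=
  if (c.t : ℝ) ≤ Real.pi / 4 then .inner c.i else .outer c.i c.j

end TreeCoord

namespace TreeEdge

/-- The distance from the centre of the tree to an edge. -/
def offset : TreeEdge → ℝ
  | inner _ => 0
  | outer _ _ => Real.pi / 4

/-- The coordinates of the points of an edge. -/
def coord : TreeEdge → Set.Icc (0 : ℝ) (Real.pi / 4) → TreeCoord
  | inner i, t => ⟨i, 0, t, t.2.1, by linarith [t.2.2, Real.pi_pos]⟩
  | outer i j, t => ⟨i, j, Real.pi / 4 + t, by linarith [t.2.1, Real.pi_pos], by linarith [t.2.2]⟩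

variable (e : TreeEdge) (s t : Set.Icc (0 : ℝ) (Real.pi / 4))

theorem param_eq : e.param t = (e.coord t).toTree := by
  cases e <;> rfl

theorem coord_t : ((e.coord t).t : ℝ) = e.offset + t := by
  cases e
  · exact (zero_add _).symm
  · rfl

theorem isometry_param : Isometry e.param := by
  refine Isometry.of_dist_eq fun s t => ?_
  have h : dist (e.coord s) (e.coord t) = |((e.coord s).t : ℝ) - (e.coord t).t| := by
    cases e <;> exact TreeCoord.dist_eq_abs_of_eq rfl rfl
  rw [param_eq, param_eq, SeparationQuotient.dist_mk, h, coord_t, coord_t, add_sub_add_left_eq_sub]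
  rfl

theorem dist_param_p : dist (e.param t) ConeTree.p = e.offset + t := by
  rw [param_eq, TreeCoord.dist_toTree_p, coord_t]

theorem ofPolar_mem_modelKite_iff {r : ℝ} (hr : 0 ≤ r) :
    ofPolar r (e.offset + t) ∈ modelKite ↔ ofPolar r t ∈ modelTriangle := by
  obtain ⟨h₀, h₁⟩ := sin_mem_Icc_zero_cos t.2
  rw [ofPolar_mem_modelTriangle_iff hr t.2]
  cases e with
  | inner i =>
    simp only [offset, zero_add]
    rw [mem_modelKite_iff_of_im_le_re, ofPolar_re, ofPolar_im]
    simp only [ofPolar_re, ofPolar_im]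
    gcongr
  | outer i j =>
    have h2 : √2 * √2 = 2 := Real.mul_self_sqrt zero_le_two
    have hre : (ofPolar r (Real.pi / 4 + t)).re = √2 / 2 * (r * (Real.cos t - Real.sin t)) := by
      rw [ofPolar_re, Real.cos_add, Real.cos_pi_div_four, Real.sin_pi_div_four]
      ring
    have him : (ofPolar r (Real.pi / 4 + t)).im = √2 / 2 * (r * (Real.cos t + Real.sin t)) := by
      rw [ofPolar_im, Real.sin_add, Real.cos_pi_div_four, Real.sin_pi_div_four]
      ring
    rw [offset, mem_modelKite_iff_of_re_le_im, hre, him]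
    · have heq : (√2 - 1) * (√2 / 2 * (r * (Real.cos t - Real.sin t))) +
          √2 / 2 * (r * (Real.cos t + Real.sin t)) =
          r * Real.cos t + (√2 - 1) * (r * Real.sin t) := by
        linear_combination r * (Real.cos t - Real.sin t) / 2 * h2
      rw [heq]
    · rw [hre, him]
      gcongr
      linarith

theorem exists_param_edge_eq (c : TreeCoord) : ∃ t, c.edge.param t = c.toTree := by
  have hπ := Real.pi_pos
  unfold TreeCoord.edge
  split_ifs with h
  · refine ⟨⟨c.t, c.t_nonneg, h⟩, SeparationQuotient.mk_eq_mk.2 (Metric.inseparable_iff.2 ?_)⟩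
    refine TreeCoord.dist_eq_zero_iff.2 ⟨rfl, ?_⟩
    simp only [TreeCoord.overlap, if_true]
    split_ifs <;> linarith
  · obtain ⟨t, ht⟩ : ∃ t : Set.Icc (0 : ℝ) (Real.pi / 4), (t : ℝ) = c.t - Real.pi / 4 :=
      ⟨⟨c.t - Real.pi / 4, by linarith, by linarith [c.t_le]⟩, rfl⟩
    refine ⟨t, SeparationQuotient.mk_eq_mk.2 (Metric.inseparable_iff.2 ?_)⟩
    change dist (coord (outer c.i c.j) t) c = 0
    have hdist : dist (coord (outer c.i c.j) t) c = |((coord (outer c.i c.j) t).t : ℝ) - c.t| :=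
      TreeCoord.dist_eq_abs_of_eq rfl rfl
    rw [hdist, coord_t, ht, offset, add_sub_cancel, sub_self, abs_zero]

instance : Countable TreeEdge :=
  Function.Injective.countable (f := fun e : TreeEdge => match e with
    | .inner i => (Sum.inl i : ℕ ⊕ ℕ × ℕ)
    | .outer i j => Sum.inr (i, j)) (by rintro (_ | _) (_ | _) h <;> simp_all)

end TreeEdge

theorem exists_eq_point_toTree (x : EuclideanCone ConeTree) :
    ∃ r, ∃ c : TreeCoord, x = EuclideanCone.point r c.toTree := by
  obtain ⟨r, y, rfl⟩ := EuclideanCone.exists_eq_point x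
  obtain ⟨c, rfl⟩ := SeparationQuotient.surjective_mk y
  exact ⟨r, c, rfl⟩

namespace TreeCoord

theorem fold_point (r : ℝ≥0) (c : TreeCoord) :
    EuclideanCone.fold ConeTree.p (EuclideanCone.point r c.toTree) = ofPolar r c.t := by
  rw [EuclideanCone.fold_point, dist_toTree_p, min_eq_right]
  linarith [c.t_le, Real.pi_pos]

theorem point_mem_coneTriangle_edge {r : ℝ≥0} {c : TreeCoord} (h : ofPolar r c.t ∈ modelKite) :
    EuclideanCone.point r c.toTree ∈ coneTriangle c.edge := by
  obtain ⟨t, ht⟩ := TreeEdge.exists_param_edge_eq c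
  have hct : (c.t : ℝ) = c.edge.offset + t := by rw [← dist_toTree_p, ← ht, TreeEdge.dist_param_p]
  rw [hct, TreeEdge.ofPolar_mem_modelKite_iff _ _ r.coe_nonneg] at h
  exact ⟨r, t, h, by rw [ht]⟩

end TreeCoord

theorem exists_mem_coneTriangle_iff {x : EuclideanCone ConeTree} :
    (∃ e, x ∈ coneTriangle e) ↔ EuclideanCone.fold ConeTree.p x ∈ modelKite := by
  constructor
  · rintro ⟨e, r, t, h, rfl⟩
    rw [e.param_eq, TreeCoord.fold_point, TreeEdge.coord_t]
    exact (e.ofPolar_mem_modelKite_iff t r.2).2 h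
  · obtain ⟨r, c, rfl⟩ := exists_eq_point_toTree x
    rw [TreeCoord.fold_point]
    exact fun h => ⟨c.edge, TreeCoord.point_mem_coneTriangle_edge h⟩

theorem isClosed_modelTriangle : IsClosed modelTriangle :=
  ((Set.toFinite _).isCompact_convexHull ℝ).isClosed

theorem le_two_of_ofPolar_mem_modelTriangle {r : ℝ≥0} {t : ℝ}
    (hz : ofPolar r t ∈ modelTriangle) : r ≤ 2 := by
  have hr : (r : ℝ) = ‖ofPolar r t‖ := (norm_ofPolar r.coe_nonneg t).symm
  rw [← NNReal.coe_le_coe, hr]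
  refine mem_closedBall_zero_iff.1 (convexHull_min ?_ (convex_closedBall 0 2) hz)
  rintro w (rfl | rfl | rfl)
  · simp
  · simp
  · rw [mem_closedBall_zero_iff, norm_mul, Complex.norm_exp_ofReal_mul_I]
    simp

theorem isCompact_coneTriangle (e : TreeEdge) : IsCompact (coneTriangle e) := by
  have hK : IsCompact {z : ℝ≥0 × Set.Icc (0 : ℝ) (Real.pi / 4) |
      ofPolar z.1 z.2 ∈ modelTriangle} := by
    refine IsCompact.of_isClosed_subset
      ((isCompact_Icc (a := (0 : ℝ≥0)) (b := 2)).prod isCompact_univ)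
      (isClosed_modelTriangle.preimage (by unfold ofPolar; fun_prop)) ?_
    rintro ⟨r, t⟩ h
    exact ⟨⟨zero_le, le_two_of_ofPolar_mem_modelTriangle h⟩, trivial⟩
  convert hK.image (EuclideanCone.continuous_point.comp
    (continuous_id.prodMap e.isometry_param.continuous)) using 1
  ext x
  constructor
  · rintro ⟨r, t, h, rfl⟩
    exact ⟨(r, t), h, rfl⟩
  · rintro ⟨⟨r, t⟩, h, rfl⟩
    exact ⟨r, t, h, rfl⟩

namespace TruncatedCone

instance : CompleteSpace TruncatedCone := by
  refine IsClosed.completeSpace_coe (s := {x | ∃ e, x ∈ coneTriangle e}) (hs := ?_)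
  simp only [exists_mem_coneTriangle_iff]
  exact isClosed_modelKite.preimage (EuclideanCone.continuous_fold _)

theorem isBounded_univ : Bornology.IsBounded (Set.univ : Set TruncatedCone) := by
  refine (Metric.isBounded_iff_subset_closedBall o).2 ⟨2, ?_⟩
  rintro ⟨_, e, r, t, h, rfl⟩ -
  refine (EuclideanCone.dist_point_zero _ _ _).trans_le ?_
  exact_mod_cast le_two_of_ofPolar_mem_modelTriangle h

theorem separableSpace : TopologicalSpace.SeparableSpace TruncatedCone := by
  refine TopologicalSpace.IsSeparable.separableSpace (s := {x | ∃ e, x ∈ coneTriangle e}) ?_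
  rw [Set.ofPred_exists]
  exact .iUnion fun e => (isCompact_coneTriangle e).isSeparable

end TruncatedCone

/-! ### Convexity of the truncated cone -/

section Kite

variable {s : ℝ} {a b ρ m α β ψ : ℝ}

/-- If the functional increases with the imaginary part, then reflecting the part of the segment
below the real axis to the upper half plane moves it below the chord from `u` to `v`. -/
theorem add_abs_im_lineMap_le {P Q M : ℝ} {u v : ℂ} (hs : s ∈ Set.Icc (0 : ℝ) 1)
    (hu : 0 ≤ u.im) (hv : 0 ≤ v.im) (hQ : 0 ≤ Q ∨ u.im = 0 ∨ v.im = 0)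
    (huM : P * u.re + Q * u.im ≤ M) (hvM : P * v.re + Q * v.im ≤ M) :
    P * (AffineMap.lineMap u (starRingEnd ℂ v) s : ℂ).re +
      Q * |(AffineMap.lineMap u (starRingEnd ℂ v) s : ℂ).im| ≤ M := by
  have hs₀ := hs.1
  have hs' : 0 ≤ 1 - s := sub_nonneg.2 hs.2
  have hu' := mul_nonneg hs' hu
  have hv' := mul_nonneg hs.1 hv
  simp only [AffineMap.lineMap_apply_module, Complex.add_re, Complex.add_im, Complex.smul_re,
    Complex.smul_im, Complex.conj_re, Complex.conj_im, smul_eq_mul, mul_neg, ← sub_eq_add_neg]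
  have hle : Q * |(1 - s) * u.im - s * v.im| ≤ Q * ((1 - s) * u.im + s * v.im) := by
    rcases hQ with hQ | h0 | h0
    · gcongr
      exact abs_le.2 ⟨by linarith, by linarith⟩
    · rw [h0, mul_zero, zero_sub, abs_neg, abs_of_nonneg hv', zero_add]
    · rw [h0, mul_zero, sub_zero, abs_of_nonneg hu', add_zero]
  calc P * ((1 - s) * u.re + s * v.re) + Q * |(1 - s) * u.im - s * v.im|
      ≤ (1 - s) * (P * u.re + Q * u.im) + s * (P * v.re + Q * v.im) := by linarith
    _ ≤ (1 - s) * M + s * M := by gcongr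
    _ = M := by ring

theorem linear_ofPolar_add (A B r t : ℝ) :
    A * (ofPolar r (m + t)).re + B * (ofPolar r (m + t)).im =
      (A * Real.cos m + B * Real.sin m) * (ofPolar r t).re +
        (B * Real.cos m - A * Real.sin m) * (ofPolar r t).im := by
  simp only [ofPolar_re, ofPolar_im, Real.cos_add, Real.sin_add]
  ring

theorem linear_ofPolar_add_abs_le {A B M : ℝ} (ha : 0 ≤ a) (hb : 0 ≤ b) (hρ₀ : 0 ≤ ρ)
    (hα : α ∈ Set.Icc 0 Real.pi) (hβ : β ∈ Set.Icc 0 Real.pi) (hψ : |ψ| ≤ Real.pi)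
    (hs : s ∈ Set.Icc (0 : ℝ) 1)
    (hρ : ofPolar ρ ψ = AffineMap.lineMap (ofPolar a α) (ofPolar b (-β)) s)
    (hQ : 0 ≤ B * Real.cos m - A * Real.sin m ∨ α = 0 ∨ β = 0)
    (haM : A * (ofPolar a (m + α)).re + B * (ofPolar a (m + α)).im ≤ M)
    (hbM : A * (ofPolar b (m + β)).re + B * (ofPolar b (m + β)).im ≤ M) :
    A * (ofPolar ρ (m + |ψ|)).re + B * (ofPolar ρ (m + |ψ|)).im ≤ M := by
  rw [linear_ofPolar_add] at haM hbM ⊢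
  have hconj : ofPolar b (-β) = starRingEnd ℂ (ofPolar b β) := by
    apply Complex.ext <;> simp
  have hre : (ofPolar ρ |ψ|).re = (ofPolar ρ ψ).re := by simp
  have him : (ofPolar ρ |ψ|).im = |(ofPolar ρ ψ).im| := by
    rw [ofPolar_im, ofPolar_im, abs_mul, abs_of_nonneg hρ₀, Real.abs_sin_eq_sin_abs_of_abs_le_pi hψ]
  rw [hre, him, hρ, hconj]
  refine add_abs_im_lineMap_le hs ?_ ?_ ?_ haM hbM
  · exact mul_nonneg ha (Real.sin_nonneg_of_mem_Icc hα) |>.trans_eq (ofPolar_im a α).symm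
  · exact mul_nonneg hb (Real.sin_nonneg_of_mem_Icc hβ) |>.trans_eq (ofPolar_im b β).symm
  · refine hQ.imp_right (Or.imp ?_ ?_) <;> rintro rfl <;> simp

theorem ofPolar_re_le_im_of_pi_div_four {r t : ℝ} (hr : 0 ≤ r) (ht : t ∈ Set.Icc 0 Real.pi) :
    (ofPolar r (Real.pi / 4 + t)).re ≤ (ofPolar r (Real.pi / 4 + t)).im := by
  have h := Real.sin_nonneg_of_mem_Icc ht
  rw [ofPolar_re, ofPolar_im, Real.cos_add, Real.sin_add, Real.cos_pi_div_four,
    Real.sin_pi_div_four]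
  gcongr
  nlinarith [Real.sqrt_nonneg 2]

theorem ofPolar_add_abs_mem_modelKite (ha : 0 ≤ a) (hb : 0 ≤ b) (hρ₀ : 0 ≤ ρ)
    (hα : α ∈ Set.Icc 0 Real.pi) (hβ : β ∈ Set.Icc 0 Real.pi) (hψ : |ψ| ≤ Real.pi)
    (hs : s ∈ Set.Icc (0 : ℝ) 1)
    (hρ : ofPolar ρ ψ = AffineMap.lineMap (ofPolar a α) (ofPolar b (-β)) s)
    (hm : α = 0 ∨ β = 0 ∨ m = 0 ∨ m = Real.pi / 4)
    (ha' : ofPolar a (m + α) ∈ modelKite) (hb' : ofPolar b (m + β) ∈ modelKite) :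
    ofPolar ρ (m + |ψ|) ∈ modelKite := by
  have hQ₁ : m = Real.pi / 4 ∨
      (0 ≤ (√2 - 1) * Real.cos m - 1 * Real.sin m ∨ α = 0 ∨ β = 0) := by
    rcases hm with h | h | rfl | h
    · exact Or.inr (Or.inr (Or.inl h))
    · exact Or.inr (Or.inr (Or.inr h))
    · refine Or.inr (Or.inl ?_)
      simp [one_lt_sqrt_two.le]
    · exact Or.inl h
  have hQ₂ : 0 ≤ 1 * Real.cos m - (√2 - 1) * Real.sin m ∨ α = 0 ∨ β = 0 := by
    rcases hm with h | h | rfl | rfl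
    · exact Or.inr (Or.inl h)
    · exact Or.inr (Or.inr h)
    · simp
    · left
      rw [Real.cos_pi_div_four, Real.sin_pi_div_four, ← sub_mul]
      exact mul_nonneg (by linarith [sqrt_two_lt_two]) (by positivity)
  have hle₂ := linear_ofPolar_add_abs_le ha hb hρ₀ hα hβ hψ hs hρ hQ₂
    (by simpa only [one_mul] using ha'.2) (by simpa only [one_mul] using hb'.2)
  rw [one_mul] at hle₂
  rcases hQ₁ with rfl | hQ₁
  · exact (mem_modelKite_iff_of_re_le_im
      (ofPolar_re_le_im_of_pi_div_four hρ₀ ⟨abs_nonneg ψ, hψ⟩)).2 hle₂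
  · have hle₁ := linear_ofPolar_add_abs_le ha hb hρ₀ hα hβ hψ hs hρ hQ₁
      (by simpa only [one_mul] using ha'.1) (by simpa only [one_mul] using hb'.1)
    rw [one_mul] at hle₁
    exact ⟨hle₁, hle₂⟩

end Kite

theorem TreeCoord.edge_mem {c w : TreeCoord} (hi : w.i = c.i) (hj : w.j = c.j) :
    w.edge ∈ ({.inner c.i, .outer c.i c.j} : Set TreeEdge) := by
  unfold TreeCoord.edge
  split_ifs
  · exact Or.inl (by rw [hi])
  · exact Or.inr (by rw [hi, hj]; rfl)

theorem TreeCoord.exists_isStewartPoint_point {a b : ℝ≥0} {c d : TreeCoord} {s : ℝ}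
    (ha : ofPolar a c.t ∈ modelKite) (hb : ofPolar b d.t ∈ modelKite)
    (hs : s ∈ Set.Icc (0 : ℝ) 1) :
    ∃ ρ : ℝ≥0, ∃ w : TreeCoord, (w.i = c.i ∧ w.j = c.j ∨ w.i = d.i ∧ w.j = d.j) ∧
      ofPolar ρ w.t ∈ modelKite ∧
      IsStewartPoint (EuclideanCone.point a c.toTree) (EuclideanCone.point b d.toTree) s
        (EuclideanCone.point ρ w.toTree) := by
  have hπ := Real.pi_pos
  have hα : c.t - meet c d ∈ Set.Icc 0 Real.pi :=
    ⟨sub_nonneg.2 (meet_le_left c d), by linarith [c.t_le, meet_nonneg c d]⟩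
  have hβ : d.t - meet c d ∈ Set.Icc 0 Real.pi :=
    ⟨sub_nonneg.2 (meet_le_right c d), by linarith [d.t_le, meet_nonneg c d]⟩
  have hcd : dist c d = c.t - meet c d - -(d.t - meet c d) := by
    rw [dist_def]
    ring
  obtain ⟨ρ, ψ, ⟨hdψ, hψc⟩, hρ⟩ := exists_ofPolar_eq_add (a := (1 - s) * a) (b := s * b)
    (α := c.t - meet c d) (δ := -(d.t - meet c d))
    (mul_nonneg (sub_nonneg.2 hs.2) a.2) (mul_nonneg hs.1 b.2) (by linarith [hα.1, hβ.1])
    (by linarith [c.dist_le_pi d])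
  rw [← lineMap_ofPolar] at hρ
  obtain ⟨w, hw, hwt, hwc, hwd⟩ := exists_mem_path hdψ hψc
  refine ⟨ρ, w, hw, ?_, ConeTree.isZeroHyperbolic.isStewartPoint ConeTree.dist_le_pi hdψ hψc hcd hwc
    (hwd.trans (by ring)) hs hρ⟩
  rw [hwt]
  refine ofPolar_add_abs_mem_modelKite a.2 b.2 ρ.2 hα hβ
    (abs_le.2 ⟨by linarith [hβ.2], hψc.trans hα.2⟩) hs hρ ?_ (by rwa [add_sub_cancel])
    (by rwa [add_sub_cancel])
  rw [sub_eq_zero, sub_eq_zero, eq_comm, eq_comm (a := (d.t : ℝ))]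
  exact meet_mem c d

namespace TruncatedCone

theorem exists_isStewartPoint (x y : TruncatedCone) :
    ∃ F : Set TreeEdge, F.Finite ∧ ∀ s ∈ Set.Icc (0 : ℝ) 1, ∃ m,
      IsStewartPoint x y s m ∧ ∃ e ∈ F, m ∈ triangle e := by
  obtain ⟨x, hx⟩ := x
  obtain ⟨y, hy⟩ := y
  obtain ⟨a, c, rfl⟩ := exists_eq_point_toTree x
  obtain ⟨b, d, rfl⟩ := exists_eq_point_toTree y
  have ha := exists_mem_coneTriangle_iff.1 hx
  have hb := exists_mem_coneTriangle_iff.1 hy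
  rw [TreeCoord.fold_point] at ha hb
  refine ⟨{.inner c.i, .outer c.i c.j} ∪ {.inner d.i, .outer d.i d.j}, Set.toFinite _,
    fun s hs => ?_⟩
  obtain ⟨ρ, w, hw, hρ, hm⟩ := TreeCoord.exists_isStewartPoint_point ha hb hs
  have hmem := TreeCoord.point_mem_coneTriangle_edge hρ
  exact ⟨⟨_, _, hmem⟩, fun p => hm p.1, w.edge,
    hw.imp (fun h => TreeCoord.edge_mem h.1 h.2) (fun h => TreeCoord.edge_mem h.1 h.2), hmem⟩

theorem isCAT0 : IsCAT0 TruncatedCone :=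
  isCAT0_of_isStewartPoint fun x y s hs =>
    let ⟨_, _, h⟩ := exists_isStewartPoint x y
    let ⟨m, hm, _⟩ := h s hs
    ⟨m, hm⟩

end TruncatedCone

/-! ### Weak limits in the truncated cone -/

namespace TreeCoord

variable {c d : TreeCoord}

theorem dist_eq_add_of_i_ne (h : c.i ≠ d.i) : dist c d = c.t + dist center d := by
  rw [dist_comm center, dist_center, dist_def, meet_eq_zero_of_ne h]
  ring

theorem dist_eq_add_of_j_ne (hct : (c.t : ℝ) = Real.pi / 2) (hdt : (d.t : ℝ) = Real.pi / 4)
    (hcd : c.i = d.i) {w : TreeCoord} (hw : c.j ≠ w.j) : dist c w = Real.pi / 4 + dist d w := by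
  have hmeet : meet c w = meet d w := by
    have hwt := w.t_le
    have hπ := Real.pi_pos
    simp only [meet, overlap, hct, hdt, hcd, hw, if_false]
    grind
  rw [dist_def, dist_def, hmeet, hct, hdt]
  ring

end TreeCoord

theorem exists_point_mem_coneTriangle_of_le_one {r : ℝ≥0} (hr : r ≤ 1) (c : TreeCoord) :
    ∃ e, EuclideanCone.point r c.toTree ∈ coneTriangle e := by
  rw [exists_mem_coneTriangle_iff, TreeCoord.fold_point]
  exact ofPolar_mem_modelKite_of_le_one r.2 hr

namespace TruncatedCone

/-- The points `1 · e i j` of the truncated cone. -/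
def outerPoint (i j : ℕ) : TruncatedCone :=
  ⟨EuclideanCone.point 1 (TreeCoord.toTree ⟨i, j, Real.pi / 2, by positivity, le_rfl⟩),
    exists_point_mem_coneTriangle_of_le_one le_rfl _⟩

/-- The points `(√2 / 2) · b i` of the truncated cone; `√2 / 2 · b i` is the closest point to
`1 · e i j` on the ray in the direction `b i`. -/
def innerPoint (i : ℕ) : TruncatedCone :=
  ⟨EuclideanCone.point (NNReal.sqrt 2 / 2)
      (TreeCoord.toTree ⟨i, 0, Real.pi / 4, by positivity, by linarith [Real.pi_pos]⟩),
    exists_point_mem_coneTriangle_of_le_one (by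
      rw [← NNReal.coe_le_coe]
      push_cast
      linarith [sqrt_two_lt_two]) _⟩

theorem weaklyConverges_outerPoint (i : ℕ) : WeaklyConverges (outerPoint i) (innerPoint i) := by
  have hπ := Real.pi_pos
  refine EuclideanCone.weaklyConverges_of_dist_eq_add ConeTree.dist_le_pi (θ := Real.pi / 4)
    (fun _ => rfl) rfl ?_ (fun j => ?_) fun w => ?_
  · simp
  · refine (TreeCoord.dist_eq_abs_of_le_overlap ?_).trans ?_
    · simp only [TreeCoord.overlap, if_true]
      split_ifs <;> simp only [inf_le_iff] <;> right <;> linarith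
    · rw [abs_of_nonneg] <;> dsimp only <;> linarith
  · obtain ⟨w, rfl⟩ := SeparationQuotient.surjective_mk w
    filter_upwards [Filter.eventually_ne_atTop w.j] with j hj
    exact TreeCoord.dist_eq_add_of_j_ne (c := ⟨i, j, Real.pi / 2, by positivity, le_rfl⟩)
      (d := ⟨i, 0, Real.pi / 4, by positivity, by linarith⟩) rfl rfl rfl hj

theorem weaklyConverges_of_i_eq {u : ℕ → TruncatedCone} {x : TruncatedCone} {c : ℕ → TreeCoord}
    {l l' : ℝ≥0} {θ : ℝ} (hu : ∀ n, (u n).1 = EuclideanCone.point l (c n).toTree)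
    (hx : x.1 = EuclideanCone.point l' ConeTree.p) (hl : (l' : ℝ) = l * Real.cos θ)
    (hc : ∀ n, (c n).i = n) (hθ : ∀ n, ((c n).t : ℝ) = θ) : WeaklyConverges u x := by
  refine EuclideanCone.weaklyConverges_of_dist_eq_add ConeTree.dist_le_pi hu hx hl
    (fun n => (TreeCoord.dist_toTree_p _).trans (hθ n)) fun w => ?_
  obtain ⟨w, rfl⟩ := SeparationQuotient.surjective_mk w
  filter_upwards [Filter.eventually_ne_atTop w.i] with n hn
  rw [← hθ n]
  exact TreeCoord.dist_eq_add_of_i_ne (by rwa [hc])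

theorem weaklyConverges_innerPoint : WeaklyConverges innerPoint halfP := by
  have h2 : √2 * √2 = 2 := Real.mul_self_sqrt zero_le_two
  refine weaklyConverges_of_i_eq (θ := Real.pi / 4) (fun _ => rfl) rfl ?_ (fun _ => rfl)
    (fun _ => rfl)
  rw [Real.cos_pi_div_four]
  push_cast
  linarith

theorem weaklyConverges_outerPoint_o (f : ℕ → ℕ) :
    WeaklyConverges (fun i => outerPoint i (f i)) o :=
  weaklyConverges_of_i_eq (θ := Real.pi / 2) (fun _ => rfl) rfl (by simp) (fun _ => rfl)
    (fun _ => rfl)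

theorem o_ne_halfP : o ≠ halfP := fun h => by
  have h' := (EuclideanCone.point_eq_point_iff.1 (congrArg Subtype.val h)).1
  simp at h'

theorem not_disjoint_weak_nhds_o_halfP :
    ¬ ∃ U V : Set TruncatedCone,
      IsOpen[weakTopology TruncatedCone] U ∧ IsOpen[weakTopology TruncatedCone] V ∧
      o ∈ U ∧ halfP ∈ V ∧ Disjoint U V :=
  not_disjoint_weak_nhds weaklyConverges_innerPoint weaklyConverges_outerPoint
    weaklyConverges_outerPoint_o

end TruncatedCone

/-! ### The simplicial structure of the truncated cone -/

/-- The vertices of the tree. -/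
inductive TreeVertex where
  | p
  | b (i : ℕ)
  | e (i j : ℕ)
deriving DecidableEq, Countable

namespace TreeVertex

/-- The coordinates of a vertex. -/
def coord : TreeVertex → TreeCoord
  | p => .center
  | b i => ⟨i, 0, Real.pi / 4, by positivity, by linarith [Real.pi_pos]⟩
  | e i j => ⟨i, j, Real.pi / 2, by positivity, le_rfl⟩

/-- The vertex as a point of the tree. -/
def toTree (v : TreeVertex) : ConeTree := v.coord.toTree

end TreeVertex

namespace TreeEdge

/-- The endpoint of an edge that is closer to the centre of the tree. -/
def source : TreeEdge → TreeVertex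
  | inner _ => .p
  | outer i _ => .b i

/-- The endpoint of an edge that is farther from the centre of the tree. -/
def target : TreeEdge → TreeVertex
  | inner i => .b i
  | outer i j => .e i j

theorem source_ne_target (e : TreeEdge) : e.source ≠ e.target := by
  cases e <;> simp [source, target]

theorem eq_of_endpoints_subset {e e' : TreeEdge} (hs : e.source = e'.source ∨ e.source = e'.target)
    (ht : e.target = e'.source ∨ e.target = e'.target) : e = e' := by
  cases e <;> cases e' <;> simp_all [source, target]

theorem param_zero (e : TreeEdge) : e.param ⟨0, le_rfl, by positivity⟩ = e.source.toTree := by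
  have hπ := Real.pi_pos
  rw [param_eq]
  refine SeparationQuotient.mk_eq_mk.2 (Metric.inseparable_iff.2 (TreeCoord.dist_eq_zero_iff.2 ?_))
  cases e <;>
    simp only [coord, source, TreeVertex.coord, TreeCoord.center, TreeCoord.overlap, add_zero,
      if_true, true_and] <;>
    split_ifs <;> linarith

theorem param_pi_div_four (e : TreeEdge) :
    e.param ⟨Real.pi / 4, by positivity, le_rfl⟩ = e.target.toTree := by
  have hπ := Real.pi_pos
  rw [param_eq]
  refine SeparationQuotient.mk_eq_mk.2 (Metric.inseparable_iff.2 (TreeCoord.dist_eq_zero_iff.2 ?_))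
  cases e <;> simp only [coord, target, TreeVertex.coord, TreeCoord.overlap, if_true] <;> grind

variable (e : TreeEdge) (t : Set.Icc (0 : ℝ) (Real.pi / 4))

theorem dist_param_source : dist (e.param t) e.source.toTree = t := by
  rw [← param_zero, e.isometry_param.dist_eq, Subtype.dist_eq, Real.dist_eq, sub_zero,
    abs_of_nonneg t.2.1]

theorem dist_param_target : dist (e.param t) e.target.toTree = Real.pi / 4 - t := by
  rw [← param_pi_div_four, e.isometry_param.dist_eq, Subtype.dist_eq, Real.dist_eq, abs_sub_comm,
    abs_of_nonneg (sub_nonneg.2 t.2.2)]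

theorem pi_div_four_le_dist_param {v : TreeVertex} (hs : v ≠ e.source) (ht : v ≠ e.target) :
    Real.pi / 4 ≤ dist (e.param t) v.toTree := by
  have hπ := Real.pi_pos
  obtain ⟨h₀, h₁⟩ := t.2
  rw [param_eq, TreeVertex.toTree, SeparationQuotient.dist_mk, TreeCoord.dist_def, coord_t]
  simp only [TreeCoord.meet, coord_t, TreeCoord.overlap]
  cases e <;> cases v <;> simp only [offset, coord, TreeVertex.coord, TreeCoord.center] <;>
    grind [source, target]

theorem exists_eq_param (y : ConeTree) : ∃ (e : TreeEdge) (t : _), y = e.param t := by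
  obtain ⟨c, rfl⟩ := SeparationQuotient.surjective_mk y
  obtain ⟨t, ht⟩ := exists_param_edge_eq c
  exact ⟨_, t, ht.symm⟩

theorem exists_eq_param_of_pi_div_four_le_dist {y : ConeTree}
    (hy : ∀ v : TreeVertex, v ≠ e.source → v ≠ e.target → Real.pi / 4 ≤ dist y v.toTree) :
    ∃ t, y = e.param t := by
  have hend : ∀ v : TreeVertex, dist y v.toTree < Real.pi / 4 → v = e.source ∨ v = e.target := by
    intro v hv
    by_contra! h
    exact (hy v h.1 h.2).not_gt hv
  have hvertex : ∀ v : TreeVertex, y = v.toTree → ∃ t, y = e.param t := by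
    rintro v rfl
    rcases hend v (by rw [dist_self]; positivity) with rfl | rfl
    · exact ⟨_, e.param_zero.symm⟩
    · exact ⟨_, e.param_pi_div_four.symm⟩
  obtain ⟨e', t, rfl⟩ := exists_eq_param y
  rcases t.2.1.eq_or_lt with h₀ | h₀
  · exact hvertex e'.source (by rw [← param_zero]; exact congrArg _ (Subtype.ext h₀.symm))
  rcases t.2.2.eq_or_lt with h₁ | h₁
  · exact hvertex e'.target (by rw [← param_pi_div_four]; exact congrArg _ (Subtype.ext h₁))
  obtain rfl := eq_of_endpoints_subset (hend _ (by rwa [dist_param_source]))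
    (hend _ (by rw [dist_param_target]; linarith))
  exact ⟨t, rfl⟩

/-- The vertices of the triangle over an edge; `none` stands for the tip of the cone. -/
def simplex : Finset (Option TreeVertex) := Finset.insertNone {e.source, e.target}

theorem card_simplex : e.simplex.card = 3 := by
  rw [simplex, Finset.card_insertNone, Finset.card_pair e.source_ne_target]

theorem sum_simplex (f : Option TreeVertex → ℝ) :
    ∑ v ∈ e.simplex, f v = f none + (f (some e.source) + f (some e.target)) := by
  rw [simplex, Finset.sum_insertNone, Finset.sum_pair e.source_ne_target]

end TreeEdge

/-- The simplicial cone over the tree, as a graph: its simplices are the nonempty subsets of the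
triangles over the edges. -/
def coneComplex : AbstractSimplicialComplex (Option TreeVertex) where
  faces := {s | s.Nonempty ∧ ∃ e : TreeEdge, s ⊆ e.simplex}
  isRelLowerSet_faces := fun _ ⟨h, e, he⟩ => ⟨h, fun _ hb hb' => ⟨hb', e, hb.trans he⟩⟩
  singleton_mem v := by
    have hmem : ∃ e : TreeEdge, v ∈ e.simplex := by
      rcases v with _ | _ | i | ⟨i, j⟩
      · exact ⟨.inner 0, by simp [TreeEdge.simplex]⟩
      · exact ⟨.inner 0, by simp [TreeEdge.simplex, TreeEdge.source]⟩
      · exact ⟨.inner i, by simp [TreeEdge.simplex, TreeEdge.target]⟩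
      · exact ⟨.outer i j, by simp [TreeEdge.simplex, TreeEdge.target]⟩
    exact ⟨Finset.singleton_nonempty v, hmem.imp fun _ h => Finset.singleton_subset_iff.2 h⟩

theorem TreeEdge.simplex_mem_faces (e : TreeEdge) : e.simplex ∈ coneComplex.faces :=
  ⟨Finset.card_pos.1 (by rw [e.card_simplex]; norm_num), e, subset_rfl⟩

theorem cos_le_sin_iff {t : ℝ} (ht : t ∈ Set.Icc 0 Real.pi) :
    Real.cos t ≤ Real.sin t ↔ Real.pi / 4 ≤ t := by
  have hmem : |Real.pi / 2 - t| ∈ Set.Icc 0 Real.pi :=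
    ⟨abs_nonneg _, abs_le.2 ⟨by linarith [ht.2, Real.pi_pos], by linarith [ht.1, Real.pi_pos]⟩⟩
  rw [← Real.cos_pi_div_two_sub, ← Real.cos_abs (Real.pi / 2 - t),
    Real.strictAntiOn_cos.le_iff_ge ht hmem, abs_le]
  exact ⟨fun h => by linarith [h.2], fun h => ⟨by linarith [Real.pi_pos], by linarith⟩⟩

namespace TruncatedCone

open TreeEdge

/-- The barycentric coordinate, at the vertex `2 · v`, of a point of the truncated cone: the
function that is affine on each triangle, equal to `1` at `2 · v`, and `0` at the other vertices. -/
def vertexCoord (v : TreeVertex) (x : TruncatedCone) : ℝ :=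
  max 0 (((EuclideanCone.fold v.toTree x.1).re - (EuclideanCone.fold v.toTree x.1).im) / 2)

theorem vertexCoord_nonneg (v : TreeVertex) (x : TruncatedCone) : 0 ≤ vertexCoord v x :=
  le_max_left _ _

section

variable {x : TruncatedCone} {r : ℝ≥0} {y : ConeTree}

theorem vertexCoord_eq (v : TreeVertex) (hx : x.1 = EuclideanCone.point r y) :
    vertexCoord v x =
      max 0 (r * (Real.cos (dist y v.toTree) - Real.sin (dist y v.toTree)) / 2) := by
  rw [vertexCoord, hx, EuclideanCone.fold_point, min_eq_right (ConeTree.dist_le_pi _ _), ofPolar_re,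
    ofPolar_im, mul_sub]

theorem vertexCoord_eq_zero_iff (v : TreeVertex) (hx : x.1 = EuclideanCone.point r y) :
    vertexCoord v x = 0 ↔ r = 0 ∨ Real.pi / 4 ≤ dist y v.toTree := by
  rw [← cos_le_sin_iff ⟨dist_nonneg, ConeTree.dist_le_pi _ _⟩, vertexCoord_eq v hx,
    max_eq_left_iff]
  rcases eq_or_ne r 0 with rfl | hr
  · simp
  · rw [or_iff_right hr, ← not_lt, ← not_lt, mul_div_right_comm,
      mul_pos_iff_of_pos_left (by positivity), sub_pos]

end

variable {e : TreeEdge} {x : TruncatedCone} {r : ℝ≥0} {t : Set.Icc (0 : ℝ) (Real.pi / 4)}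

theorem vertexCoord_source (hx : x.1 = EuclideanCone.point r (e.param t)) :
    vertexCoord e.source x = ((ofPolar r t).re - (ofPolar r t).im) / 2 := by
  have h := (sin_mem_Icc_zero_cos t.2).2
  rw [vertexCoord_eq _ hx, dist_param_source, ofPolar_re, ofPolar_im, ← mul_sub, max_eq_right]
  have := sub_nonneg.2 h
  positivity

theorem vertexCoord_target (hx : x.1 = EuclideanCone.point r (e.param t)) :
    vertexCoord e.target x = √2 / 2 * (ofPolar r t).im := by
  have h : Real.cos (Real.pi / 4 - t) - Real.sin (Real.pi / 4 - t) = √2 * Real.sin t := by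
    rw [Real.cos_sub, Real.sin_sub, Real.cos_pi_div_four, Real.sin_pi_div_four]
    ring
  have h₀ := (sin_mem_Icc_zero_cos t.2).1
  rw [vertexCoord_eq _ hx, dist_param_target, h, ofPolar_im, max_eq_right (by positivity)]
  ring

theorem mem_triangle_of_eq_point_param (hx : x.1 = EuclideanCone.point r (e.param t)) :
    x ∈ triangle e := by
  refine ⟨r, t, ?_, hx⟩
  have h := exists_mem_coneTriangle_iff.1 x.2
  rwa [hx, e.param_eq, TreeCoord.fold_point, TreeEdge.coord_t,
    e.ofPolar_mem_modelKite_iff t r.coe_nonneg] at h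

theorem vertexCoord_eq_zero_off_iff :
    (∀ v, v ≠ e.source → v ≠ e.target → vertexCoord v x = 0) ↔ x ∈ triangle e := by
  constructor
  · intro h
    obtain ⟨r, y, hx⟩ := EuclideanCone.exists_eq_point x.1
    have hmem : ∃ t, x.1 = EuclideanCone.point r (e.param t) := by
      rcases eq_or_ne r 0 with rfl | hr
      · exact ⟨⟨0, le_rfl, by positivity⟩,
          hx.trans (EuclideanCone.point_eq_point_iff.2 ⟨rfl, Or.inl rfl⟩)⟩
      · obtain ⟨t, rfl⟩ := exists_eq_param_of_pi_div_four_le_dist e fun v hs ht =>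
          ((vertexCoord_eq_zero_iff v hx).1 (h v hs ht)).resolve_left hr
        exact ⟨t, hx⟩
    exact hmem.elim fun t ht => mem_triangle_of_eq_point_param ht
  · intro hx v hs ht
    obtain ⟨r, t, -, hx⟩ := hx
    exact (vertexCoord_eq_zero_iff v hx).2 (Or.inr (e.pi_div_four_le_dist_param t hs ht))

/-- The barycentric coordinates of a point of the truncated cone; `none` stands for the tip. -/
def bary (x : TruncatedCone) : Option TreeVertex → ℝ
  | none => 1 - ∑ᶠ v, vertexCoord v x
  | some v => vertexCoord v x

theorem support_bary_subset_iff (x : TruncatedCone) (e : TreeEdge) :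
    Function.support (bary x) ⊆ e.simplex ↔ x ∈ triangle e := by
  rw [← vertexCoord_eq_zero_off_iff, Function.support_subset_iff', Option.forall]
  simp [simplex, bary]

theorem bary_none (hx : x ∈ triangle e) :
    bary x none = 1 - (vertexCoord e.source x + vertexCoord e.target x) := by
  rw [bary, finsum_eq_sum_of_support_subset (s := {e.source, e.target}),
    Finset.sum_pair e.source_ne_target]
  rw [Function.support_subset_iff']
  intro v hv
  simp only [Finset.coe_insert, Finset.coe_singleton, Set.mem_insert_iff, Set.mem_singleton_iff,
    not_or] at hv
  exact vertexCoord_eq_zero_off_iff.2 hx v hv.1 hv.2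

theorem sum_bary (hx : x ∈ triangle e) : ∑ v ∈ e.simplex, bary x v = 1 := by
  rw [sum_simplex, bary_none hx]
  exact sub_add_cancel _ _

theorem bary_nonneg (x : TruncatedCone) (v : Option TreeVertex) : 0 ≤ bary x v := by
  cases v with
  | some v => exact vertexCoord_nonneg v x
  | none =>
    obtain ⟨e, he⟩ := x.2
    rw [bary_none he]
    obtain ⟨r, t, hz, hx⟩ := he
    obtain ⟨-, -, hz⟩ := (mem_modelTriangle_iff (z := ofPolar r t)).1 hz
    rw [vertexCoord_source hx, vertexCoord_target hx]
    linarith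

/-- The squared lengths of the orthogonal vectors that represent the vertices of a triangle, scaled
such that the distances of the vertices are the side lengths of the triangle. -/
def vertexWeight : Option TreeVertex → ℝ
  | none => 2 * √2
  | some _ => 4 - 2 * √2

theorem vertexWeight_pos (v : Option TreeVertex) : 0 < vertexWeight v := by
  cases v <;> simp only [vertexWeight] <;> linarith [one_lt_sqrt_two, sqrt_two_lt_two]

theorem dist_sq_eq_sum {y : TruncatedCone} (hx : x ∈ triangle e) (hy : y ∈ triangle e) :
    dist x y ^ 2 = ∑ v ∈ e.simplex, vertexWeight v * (bary x v - bary y v) ^ 2 := by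
  have h2 : √2 * √2 = 2 := Real.mul_self_sqrt zero_le_two
  rw [sum_simplex, bary_none hx, bary_none hy]
  obtain ⟨r, t, -, hx⟩ := hx
  obtain ⟨s, u, -, hy⟩ := hy
  have hdist : dist x y = dist (ofPolar r t) (ofPolar s u) := by
    rw [Subtype.dist_eq, hx, hy, EuclideanCone.dist_point_of_le_pi ConeTree.dist_le_pi,
      e.isometry_param.dist_eq, Subtype.dist_eq, Real.dist_eq, coneDist_abs, dist_ofPolar]
  rw [hdist, Complex.dist_eq_re_im, Real.sq_sqrt (by positivity)]
  simp only [bary, vertexWeight, vertexCoord_source hx, vertexCoord_source hy,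
    vertexCoord_target hx, vertexCoord_target hy]
  generalize ofPolar r t = z
  generalize ofPolar s u = w
  linear_combination (-(z.re - w.re) * (z.im - w.im)) * h2

theorem bary_injective : Function.Injective bary := by
  intro x y h
  obtain ⟨e, hx⟩ := x.2
  have hy : y ∈ triangle e :=
    (support_bary_subset_iff y e).1 (h ▸ (support_bary_subset_iff x e).2 hx)
  have hdist := dist_sq_eq_sum hx hy
  simp only [h, sub_self, zero_pow two_ne_zero, mul_zero, Finset.sum_const_zero] at hdist
  exact dist_eq_zero.1 (pow_eq_zero_iff two_ne_zero |>.1 hdist)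

theorem exists_vertexCoord_eq {a b : ℝ} (ha : 0 ≤ a) (hb : 0 ≤ b) (hab : a + b ≤ 1)
    (e : TreeEdge) :
    ∃ x ∈ triangle e, vertexCoord e.source x = a ∧ vertexCoord e.target x = b := by
  have h2 : √2 * √2 = 2 := Real.mul_self_sqrt zero_le_two
  have hπ := Real.pi_pos
  obtain ⟨r, t, ht, hz⟩ := exists_ofPolar_eq_add (a := 2 * b) (b := 2 * a) (α := Real.pi / 4)
    (δ := 0) (by positivity) (by positivity) (by positivity) (by linarith)
  have hre : (ofPolar r t).re = √2 * b + 2 * a := by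
    rw [hz, Complex.add_re, ofPolar_re, ofPolar_re, Real.cos_pi_div_four, Real.cos_zero]
    ring
  have him : (ofPolar r t).im = √2 * b := by
    rw [hz, Complex.add_im, ofPolar_im, ofPolar_im, Real.sin_pi_div_four, Real.sin_zero]
    ring
  have hmem : ofPolar r t ∈ modelTriangle := by
    rw [mem_modelTriangle_iff, hre, him]
    exact ⟨by positivity, by linarith, by linear_combination 2 * hab + b * h2⟩
  have hx : EuclideanCone.point r (e.param ⟨t, ht⟩) ∈ coneTriangle e := ⟨r, ⟨t, ht⟩, hmem, rfl⟩
  refine ⟨⟨_, e, hx⟩, hx, ?_, ?_⟩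
  · rw [vertexCoord_source rfl, hre, him]
    ring
  · rw [vertexCoord_target rfl, him]
    linear_combination b / 2 * h2

theorem exists_bary_eq {w : Option TreeVertex → ℝ} (h₀ : ∀ v, 0 ≤ w v)
    (hw : Function.support w ⊆ e.simplex) (h₁ : ∑ v ∈ e.simplex, w v = 1) : ∃ x, bary x = w := by
  rw [sum_simplex] at h₁
  obtain ⟨x, hx, hs, ht⟩ := exists_vertexCoord_eq (h₀ (some e.source)) (h₀ (some e.target))
    (by linarith [h₀ none]) e
  have hnone : bary x none = w none := by
    rw [bary_none hx, hs, ht]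
    linarith
  have heq : ∀ v ∈ e.simplex, bary x v = w v :=
    Finset.forall_mem_insertNone.2 ⟨hnone, by simp [bary, hs, ht]⟩
  refine ⟨x, funext fun v => ?_⟩
  by_cases hv : v ∈ e.simplex
  · exact heq v hv
  · rw [Function.support_subset_iff'.1 ((support_bary_subset_iff x e).2 hx) v hv,
      Function.support_subset_iff'.1 hw v hv]

theorem range_bary : Set.range bary =
    {w | (∀ v, 0 ≤ w v) ∧ ∃ s ∈ coneComplex.faces,
      Function.support w = (s : Set (Option TreeVertex)) ∧ ∑ v ∈ s, w v = 1} := by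
  ext w
  constructor
  · rintro ⟨x, rfl⟩
    obtain ⟨e, he⟩ := x.2
    have hsupp := (support_bary_subset_iff x e).2 he
    have hsum : ∑ v ∈ e.simplex with bary x v ≠ 0, bary x v = 1 := by
      rw [Finset.sum_filter_ne_zero, sum_bary he]
    refine ⟨bary_nonneg x, e.simplex.filter (bary x · ≠ 0),
      ⟨Finset.nonempty_of_sum_ne_zero (hsum.trans_ne one_ne_zero), e, Finset.filter_subset _ _⟩,
      ?_, hsum⟩
    rw [Finset.coe_filter]
    exact Set.ext fun v => ⟨fun h => ⟨hsupp h, h⟩, fun h => h.2⟩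
  · rintro ⟨h₀, s, ⟨-, e, he⟩, hs, h₁⟩
    refine exists_bary_eq h₀ (hs.trans_subset (Finset.coe_subset.2 he)) (h₁ ▸ ?_)
    refine (Finset.sum_subset he fun v _ hv => ?_).symm
    exact Function.notMem_support.1 (by rwa [hs])


open TreeEdge

/-- The vertex `v` of the Euclidean simplex with the vertex set `s`: the vertices lie on orthogonal
axes. -/
def vertex (s : Finset (Option TreeVertex)) (v : s) : EuclideanSpace ℝ s :=
  EuclideanSpace.single v √(vertexWeight v)

theorem inner_vertex_of_ne {s : Finset (Option TreeVertex)} {v w : s} (h : v ≠ w) :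
    inner ℝ (vertex s v) (vertex s w) = 0 := by
  rw [vertex, vertex, EuclideanSpace.inner_single_left, PiLp.single_apply, if_neg h, mul_zero]

theorem norm_vertex_sq (s : Finset (Option TreeVertex)) (v : s) :
    ‖vertex s v‖ ^ 2 = vertexWeight v := by
  rw [vertex, PiLp.norm_single, Real.norm_eq_abs, sq_abs, Real.sq_sqrt (vertexWeight_pos _).le]

theorem dist_vertex_sq {s : Finset (Option TreeVertex)} {v w : s} (h : v ≠ w) :
    dist (vertex s v) (vertex s w) ^ 2 = vertexWeight v + vertexWeight w := by
  rw [dist_eq_norm, norm_sub_sq_real, inner_vertex_of_ne h, norm_vertex_sq, norm_vertex_sq,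
    mul_zero, sub_zero]

/-- The truncated cone as a Euclidean complex. -/
@[reducible] def complex : EuclideanComplex TruncatedCone where
  V := Option TreeVertex
  K := coneComplex
  bary := bary
  bary_injective := bary_injective
  range_bary := range_bary
  vertex := vertex
  affineIndependent s _ := by
    refine LinearIndependent.affineIndependent ℝ <|
      linearIndependent_of_ne_zero_of_inner_eq_zero (𝕜 := ℝ) (fun v hv => ?_)
        fun v w => inner_vertex_of_ne
    have h := norm_vertex_sq s v
    rw [hv, norm_zero, zero_pow two_ne_zero] at h
    exact (vertexWeight_pos v).ne h
  dist_vertex s _ t _ v w hvs hws hvt hwt := by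
    rcases eq_or_ne v w with rfl | h
    · rw [dist_self, dist_self]
    · refine (sq_eq_sq₀ dist_nonneg dist_nonneg).1 ?_
      rw [dist_vertex_sq (Subtype.coe_ne_coe.1 h), dist_vertex_sq (Subtype.coe_ne_coe.1 h)]

theorem closedSimplex_simplex (e : TreeEdge) : complex.closedSimplex e.simplex = triangle e :=
  Set.ext fun x => support_bary_subset_iff x e

theorem position_apply (s : Finset (Option TreeVertex)) (x : TruncatedCone) (v : s) :
    complex.position s x v = bary x v * √(vertexWeight v) := by
  change (∑ w : s, bary x w • vertex s w) v = _
  simp [vertex, Pi.single_apply]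

theorem isPiecewiseEuclidean_complex : complex.IsPiecewiseEuclidean := by
  rintro s ⟨-, e, he⟩ x hx y hy
  have hsub : complex.closedSimplex s ⊆ triangle e := fun z hz =>
    (support_bary_subset_iff z e).1 (hz.trans (Finset.coe_subset.2 he))
  have hterm : ∀ v : s, dist (complex.position s x v) (complex.position s y v) ^ 2 =
      vertexWeight v * (bary x v - bary y v) ^ 2 := fun v => by
    rw [position_apply, position_apply, Real.dist_eq, sq_abs, ← sub_mul, mul_pow,
      Real.sq_sqrt (vertexWeight_pos _).le, mul_comm]
  refine (sq_eq_sq₀ dist_nonneg dist_nonneg).1 ?_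
  rw [EuclideanSpace.dist_sq_eq, dist_sq_eq_sum (hsub hx) (hsub hy)]
  refine (Finset.sum_congr rfl fun v _ => hterm v).trans ?_
  rw [Finset.sum_coe_sort s fun v => vertexWeight v * (bary x v - bary y v) ^ 2]
  refine Finset.sum_subset he fun v _ hv => ?_
  have hx₀ : bary x v = 0 := Function.support_subset_iff'.1 hx v hv
  have hy₀ : bary y v = 0 := Function.support_subset_iff'.1 hy v hv
  rw [hx₀, hy₀, sub_zero, zero_pow two_ne_zero, mul_zero]

theorem isClosed_triangle (e : TreeEdge) : IsClosed (triangle e) :=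
  (isCompact_coneTriangle e).isClosed.preimage continuous_subtype_val

theorem inducesMetric_complex : complex.InducesMetric := by
  classical
  refine EuclideanComplex.inducesMetric_of_isGeodesic isPiecewiseEuclidean_complex fun x y => ?_
  obtain ⟨F, hF, hm⟩ := exists_isStewartPoint x y
  have : Nonempty TruncatedCone := ⟨o⟩
  choose! σ hσ hσF using hm
  obtain ⟨γ, hγ, h₀, h₁, hcov⟩ := exists_isGeodesic_of_isStewartPoint hσ
  refine ⟨γ, hF.toFinset.image simplex, hγ, h₀, h₁, Finset.forall_mem_image.2 fun e _ => ?_,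
    fun s hs => ?_⟩
  · exact ⟨e.simplex_mem_faces, closedSimplex_simplex e ▸ isClosed_triangle e⟩
  · obtain ⟨t, ht, hst⟩ := hcov s hs
    obtain ⟨e, heF, he⟩ := hσF t ht
    exact ⟨e.simplex, Finset.mem_image_of_mem _ (hF.mem_toFinset.2 heF),
      closedSimplex_simplex e ▸ hst ▸ he⟩

theorem hasDimension_complex : complex.HasDimension 2 :=
  ⟨fun _ ⟨_, e, he⟩ => (Finset.card_le_card he).trans_eq e.card_simplex,
    simplex (.inner 0), simplex_mem_faces _, card_simplex _⟩

theorem triangles_complex :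
    {S | ∃ s ∈ complex.K.faces, s.card = 3 ∧ S = complex.closedSimplex s} =
      Set.range triangle := by
  ext S
  constructor
  · rintro ⟨s, ⟨-, e, he⟩, hs, rfl⟩
    obtain rfl := Finset.eq_of_subset_of_card_le he (by rw [e.card_simplex]; exact hs.ge)
    exact ⟨e, (closedSimplex_simplex e).symm⟩
  · rintro ⟨e, rfl⟩
    exact ⟨e.simplex, simplex_mem_faces e, e.card_simplex, (closedSimplex_simplex e).symm⟩

end TruncatedCone

end

theorem mainTheorem4 :
    IsCAT0 TruncatedCone ∧
    Bornology.IsBounded (Set.univ : Set TruncatedCone) ∧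
    TopologicalSpace.SeparableSpace TruncatedCone ∧
    (∃ C : EuclideanComplex TruncatedCone,
      C.InducesMetric ∧ C.HasDimension 2 ∧ C.K.faces.Countable ∧
      {S | ∃ s ∈ C.K.faces, s.card = 3 ∧ S = C.closedSimplex s} =
        Set.range TruncatedCone.triangle) ∧
    (¬ ∃ U V : Set TruncatedCone,
      IsOpen[weakTopology TruncatedCone] U ∧ IsOpen[weakTopology TruncatedCone] V ∧
      TruncatedCone.o ∈ U ∧ TruncatedCone.halfP ∈ V ∧ Disjoint U V) ∧
    ¬ @T2Space TruncatedCone (weakTopology TruncatedCone) := by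
  exact ⟨TruncatedCone.isCAT0, TruncatedCone.isBounded_univ, TruncatedCone.separableSpace,
    ⟨TruncatedCone.complex, TruncatedCone.inducesMetric_complex,
      TruncatedCone.hasDimension_complex, Set.to_countable _, TruncatedCone.triangles_complex⟩,
    TruncatedCone.not_disjoint_weak_nhds_o_halfP,
    not_t2Space_weakTopology TruncatedCone.o_ne_halfP
      TruncatedCone.not_disjoint_weak_nhds_o_halfP⟩
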